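/- Let $\mathbb D=\{z\in\mathbb C:|z|<1\}$. A non-constant function $f:\mathbb D\to\mathbb C$ is log-harmonic if it satisfies $\overline{f_{\bar z}}/\overline{f}=w\,f_z/f$ wherever $f\ne 0$, for some analytic $w$ on $\mathbb D$ with $|w|<1$ (here $f$ is continuous on $\mathbb D$ and continuously differentiable where $f\neq 0$). Let $\mathcal{ST}^0_{LH}$ be the class of univalent log-harmonic $f$ with $f(0)=0$ such that $\operatorname{Re}\big((zf_z-\bar z f_{\bar z})/f\big)>0$ on $\mathbb D\setminus\{0\}$ and such that $f(\mathbb D)$ is starlike with respect to the origin. Theorem 2.7. The equation $\frac{r}{1-r}\,e^{4r/(1-r)}=e^{-2}$ has exactly one root $r_f$ in $(0,1)$, and $|r_f-0.08527|\le 5\cdot 10^{-6}$. Let $f\in\mathcal{ST}^0_{LH}$ have the form $f(z)=z\,h(z)\,\overline{g(z)}$ with $h(z)=\exp\big(\sum_{n\ge1}a_nz^n\big)$ and $g(z)=\exp\big(\sum_{n\ge1}b_nz^n\big)$, both series converging in $\mathbb D$. Then for every real $t$ and all $|z|\le r_f$ the series below converges and $$|z|\exp\Big(\sum_{n=1}^{\infty}\Big|a_n+e^{it}b_n+\frac{n}{4n^2-1}\,a_nb_n\Big|\,|z|^n\Big)\le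 d\big(0,\partial f(\mathbb D)\big).$$ The radius is sharp: $r_f$ is the largest $r\in(0,1)$ such that the inequality holds for all such $f$, all real $t$ and all $|z|\le r$. It is attained by the log-harmonic Koebe function $f_0(z)=z\,h_0(z)\,\overline{g_0(z)}$, where $h_0(z)=\frac1{1-z}\exp\frac{2z}{1-z}$ and $g_0(z)=(1-z)\exp\frac{2z}{1-z}$: it belongs to the class and has the stated form, and for $f=f_0$ and $t=0$ the series converges for all $|z|<1$, equality holds for $|z|=r_f$, and the inequality fails for $r_f<|z|<1$. -/

import Mathlib

open scoped ComplexConjugate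

/-- The Wirtinger derivative `f_z = (f_x - i f_y) / 2`. -/
noncomputable def wirtingerZ (f : ℂ → ℂ) (z : ℂ) : ℂ :=
  (fderiv ℝ f z 1 - Complex.I * fderiv ℝ f z Complex.I) / 2

/-- The Wirtinger derivative `f_{z̄} = (f_x + i f_y) / 2`. -/
noncomputable def wirtingerZBar (f : ℂ → ℂ) (z : ℂ) : ℂ :=
  (fderiv ℝ f z 1 + Complex.I * fderiv ℝ f z Complex.I) / 2

/-- `f` is log-harmonic in the open unit disk: a non-constant classical solution of
`conj (f_{z̄}) / conj f = w * f_z / f` for some analytic `w` with `|w| < 1`. The equation is read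
where `f ≠ 0`, and `f` is continuous on the whole disk (at a zero it may fail to be
differentiable, as `z |z|^{2β}` shows). -/
structure IsLogHarmonic (f : ℂ → ℂ) : Prop where
  continuousOn : ContinuousOn f (Metric.ball 0 1)
  contDiffOn : ContDiffOn ℝ 1 f {z | z ∈ Metric.ball (0 : ℂ) 1 ∧ f z ≠ 0}
  nonconstant : ¬ ∃ c : ℂ, ∀ z ∈ Metric.ball (0 : ℂ) 1, f z = c
  equation : ∃ w : ℂ → ℂ, DifferentiableOn ℂ w (Metric.ball 0 1) ∧
    (∀ z ∈ Metric.ball (0 : ℂ) 1, ‖w z‖ < 1) ∧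
    ∀ z ∈ Metric.ball (0 : ℂ) 1, f z ≠ 0 →
      conj (wirtingerZBar f z) / conj (f z) = w z * (wirtingerZ f z / f z)

/-- Starlike (univalent) log-harmonic mappings of the unit disk that vanish at the origin. The
quotient is undefined at the zero `z = 0` of `f`, so the condition is read for `z ≠ 0`. -/
structure IsStarlikeLogHarmonic (f : ℂ → ℂ) : Prop where
  logHarmonic : IsLogHarmonic f
  map_zero : f 0 = 0
  injOn : Set.InjOn f (Metric.ball 0 1)
  re_pos : ∀ z ∈ Metric.ball (0 : ℂ) 1, z ≠ 0 →
    0 < ((z * wirtingerZ f z - conj z * wirtingerZBar f z) / f z).re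

/-- Starlike log-harmonic mappings that map the disk onto a domain starlike about the origin. -/
structure MemST0LH (f : ℂ → ℂ) : Prop where
  starlike : IsStarlikeLogHarmonic f
  starConvex_image : StarConvex ℝ 0 (f '' Metric.ball 0 1)

/-- `h (z) = exp (∑_{n ≥ 1} a_n z ^ n)` in the unit disk, with a convergent series. The value
`a 0` is not used. -/
def IsExpSeries (h : ℂ → ℂ) (a : ℕ → ℂ) : Prop :=
  ∀ z ∈ Metric.ball (0 : ℂ) 1, Summable (fun n : ℕ => a (n + 1) * z ^ (n + 1)) ∧
    h z = Complex.exp (∑' n : ℕ, a (n + 1) * z ^ (n + 1))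

/-- `f = z h conj(g)` in the unit disk, where `h = exp (∑_{n ≥ 1} a_n z ^ n)` and
`g = exp (∑_{n ≥ 1} b_n z ^ n)`. -/
structure HasLogHarmonicRep (f h g : ℂ → ℂ) (a b : ℕ → ℂ) : Prop where
  eq_mul : ∀ z ∈ Metric.ball (0 : ℂ) 1, f z = z * h z * conj (g z)
  analytic_factor : IsExpSeries h a
  coanalytic_factor : IsExpSeries g b

/-- The `n`-th term `|a_n + e^{it} b_n + n a_n b_n / (4 n ^ 2 - 1)| r ^ n`. -/
noncomputable def bohrTerm (a b : ℕ → ℂ) (t r : ℝ) (n : ℕ) : ℝ :=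
  ‖a n + Complex.exp (t * Complex.I) * b n + (n : ℂ) / (4 * (n : ℂ) ^ 2 - 1) * a n * b n‖ * r ^ n

/-- The majorant `r exp (∑_{n ≥ 1} |a_n + e^{it} b_n + n a_n b_n / (4 n ^ 2 - 1)| r ^ n)`. -/
noncomputable def bohrMajorant (a b : ℕ → ℂ) (t r : ℝ) : ℝ :=
  r * Real.exp (∑' n : ℕ, bohrTerm a b t r (n + 1))

/-- The distance `d(0, ∂ f(𝔻))`. -/
noncomputable def distZeroBoundary (f : ℂ → ℂ) : ℝ :=
  Metric.infDist 0 (frontier (f '' Metric.ball 0 1))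

/-- The inequality (with a convergent series) holds for `|z| ≤ r`, for every mapping of the class
and every real `t`. -/
def BohrInequalityUpTo (r : ℝ) : Prop :=
  ∀ (f h g : ℂ → ℂ) (a b : ℕ → ℂ), MemST0LH f → HasLogHarmonicRep f h g a b →
    ∀ (t : ℝ) (z : ℂ), ‖z‖ ≤ r →
      Summable (fun n : ℕ => bohrTerm a b t ‖z‖ (n + 1)) ∧
        bohrMajorant a b t ‖z‖ ≤ distZeroBoundary f

/-- The analytic factor of the log-harmonic Koebe function. -/
noncomputable def koebeH (z : ℂ) : ℂ := 1 / (1 - z) * Complex.exp (2 * z / (1 - z))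

/-- The co-analytic factor of the log-harmonic Koebe function. -/
noncomputable def koebeG (z : ℂ) : ℂ := (1 - z) * Complex.exp (2 * z / (1 - z))

/-- The log-harmonic Koebe function `f₀ = z h₀ conj(g₀)`. -/
noncomputable def koebeLH (z : ℂ) : ℂ := z * koebeH z * conj (koebeG z)

/-! Write `f = z e^A conj(e^B)` and put `p = 1 + zA' - zB'`, `q = 1/(1 - w)`. The log-harmonic
equation becomes `zB' = w (1 + zA')`, so `1 + zA' = p q` and `zB' = p (q - 1)`. Here `Re p > 0`,
`p(0) = 1`, and `w(0) = 0`, so that `|w(z)| ≤ |z|`. Everything about the class follows from these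
two analytic functions.

Coefficients: Carathéodory's lemma bounds the coefficients of `p` by 2 and, applied to `2q - 1 = (1
+ w)/(1 - w)`, those of `q` by 1. Convolution gives `|a_n| ≤ 2 + 1/n` and `|b_n| ≤ 2 - 1/n`. The
weight `n/(4n² - 1)` turns the product of these bounds into `1/n`, so the exponent is at most `∑ (4
+ 1/n) r^n = 4r/(1-r) - log(1-r)`, and the left side is at most `koebeMajorant r`, which increases
with `r`.

Distance: the growth estimate `LogHarmonicData.le_norm` is a differential inequality along preimages
of rays, phrased as a minimum argument. Letting `|z| → 1` places every boundary point of the image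
at modulus at least `e^{-2}`. The radius is therefore the root of `koebeMajorant r = e^{-2}`.

Sharpness: for the Koebe function the coefficient bounds and the triangle inequality are equalities,
and its value at `-1` gives distance exactly `e^{-2}`. Its univalence and starlikeness are checked
in the coordinate `p = (1 + z)/(1 - z)`, where the mapping is `p² - 1` times a positive factor: rays
become explicit paths, along which the modulus increases strictly. -/

/-! ### Power series in the unit disk and Carathéodory's lemma. -/

/-- `f (z) = ∑ c_n z ^ n` in the open unit disk. -/
def HasDiskSeries (f : ℂ → ℂ) (c : ℕ → ℂ) : Prop :=
  ∀ z ∈ Metric.ball (0 : ℂ) 1, HasSum (fun n : ℕ => c n * z ^ n) (f z)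

namespace HasDiskSeries

variable {f g : ℂ → ℂ} {c d : ℕ → ℂ}

theorem hasFPowerSeriesAt (h : HasDiskSeries f c) :
    HasFPowerSeriesAt f (FormalMultilinearSeries.ofScalars ℂ c) 0 := by
  rw [hasFPowerSeriesAt_iff]
  filter_upwards [Metric.ball_mem_nhds (0 : ℂ) one_pos] with z hz
  simpa [FormalMultilinearSeries.coeff_ofScalars, mul_comm] using h z hz

theorem summable_norm (h : HasDiskSeries f c) {z : ℂ} (hz : z ∈ Metric.ball (0 : ℂ) 1) :
    Summable (fun n : ℕ => ‖c n * z ^ n‖) :=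
  (h z hz).summable.norm

theorem hasFPowerSeriesOnBall (h : HasDiskSeries f c) :
    HasFPowerSeriesOnBall f (FormalMultilinearSeries.ofScalars ℂ c) 0 1 where
  r_le := by
    refine le_of_forall_lt_imp_le_of_dense fun r hr => ?_
    lift r to NNReal using hr.ne_top
    refine FormalMultilinearSeries.le_radius_of_summable _ ?_
    have hr' : (r : ℝ) < 1 := by exact_mod_cast hr
    simpa using h.summable_norm (z := (r : ℝ)) (by simpa using hr')
  r_pos := one_pos
  hasSum := by
    intro y hy
    have hy' : y ∈ Metric.ball (0 : ℂ) 1 := by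
      rwa [← ENNReal.coe_one, Metric.eball_coe, NNReal.coe_one] at hy
    simpa [FormalMultilinearSeries.ofScalars_apply_eq, mul_comm] using h y hy'

theorem differentiableOn (h : HasDiskSeries f c) :
    DifferentiableOn ℂ f (Metric.ball 0 1) := by
  simpa only [← ENNReal.coe_one, Metric.eball_coe, NNReal.coe_one] using
    h.hasFPowerSeriesOnBall.differentiableOn

theorem unique (h : HasDiskSeries f c) (h' : HasDiskSeries f d) : c = d := by
  have := h.hasFPowerSeriesAt.eq_formalMultilinearSeries h'.hasFPowerSeriesAt
  ext n
  simpa [FormalMultilinearSeries.coeff_ofScalars] using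
    congrArg (fun p : FormalMultilinearSeries ℂ ℂ ℂ => p.coeff n) this

theorem of_differentiableOn (hf : DifferentiableOn ℂ f (Metric.ball 0 1)) :
    HasDiskSeries f (fun n => (n.factorial : ℂ)⁻¹ * iteratedDeriv n f 0) := by
  intro z hz
  convert! Complex.hasSum_taylorSeries_on_ball hf hz using 2 with n
  simp only [sub_zero, smul_eq_mul]
  ring

theorem congr (h : HasDiskSeries f c) (hfg : Set.EqOn f g (Metric.ball 0 1)) :
    HasDiskSeries g c := fun z hz => hfg hz ▸ h z hz

theorem mul (hf : HasDiskSeries f c) (hg : HasDiskSeries g d) :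
    HasDiskSeries (fun z => f z * g z)
      (fun n => ∑ p ∈ Finset.HasAntidiagonal.antidiagonal n, c p.1 * d p.2) := by
  intro z hz
  have h1 := hf.summable_norm hz
  have h2 := hg.summable_norm hz
  have hs := (summable_norm_sum_mul_antidiagonal_of_summable_norm h1 h2).of_norm
  have ht := tsum_mul_tsum_eq_tsum_sum_antidiagonal_of_summable_norm h1 h2
  rw [(hf z hz).tsum_eq, (hg z hz).tsum_eq] at ht
  have hs' := hs.hasSum
  rw [← ht] at hs'
  convert! hs' using 1
  ext n
  rw [Finset.sum_mul]
  refine Finset.sum_congr rfl fun p hp => ?_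
  rw [← Finset.HasAntidiagonal.mem_antidiagonal.1 hp, pow_add]
  ring

theorem add (hf : HasDiskSeries f c) (hg : HasDiskSeries g d) :
    HasDiskSeries (fun z => f z + g z) (fun n => c n + d n) := fun z hz => by
  simpa [add_mul] using (hf z hz).add (hg z hz)

theorem apply_zero (h : HasDiskSeries f c) : f 0 = c 0 := by
  have := h 0 (by simp)
  refine this.unique ?_
  simpa using hasSum_single (f := fun n : ℕ => c n * (0 : ℂ) ^ n) 0 (by simp +contextual)

theorem deriv (h : HasDiskSeries f c) :
    HasDiskSeries (deriv f) (fun n => (n + 1) * c (n + 1)) := by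
  have hd := h.differentiableOn
  have hc := h.unique (of_differentiableOn hd)
  have := of_differentiableOn (hd.deriv Metric.isOpen_ball)
  convert this using 2 with n
  simp only [hc]
  rw [← iteratedDeriv_succ', Nat.factorial_succ]
  push_cast
  field_simp

theorem id_mul_deriv (h : HasDiskSeries f c) :
    HasDiskSeries (fun z => z * _root_.deriv f z) (fun n => n * c n) := by
  intro z hz
  rw [← hasSum_nat_add_iff' 1]
  simp only [Finset.range_one, Finset.sum_singleton, Nat.cast_zero, zero_mul, sub_zero]
  convert! (h.deriv z hz).mul_left z using 2 with n
  push_cast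
  rw [pow_succ]
  ring

theorem deriv_zero (h : HasDiskSeries f c) : _root_.deriv f 0 = c 1 := by
  simpa using h.deriv.apply_zero

end HasDiskSeries

theorem norm_sub_one_div_add_one_lt {p : ℂ} (hp : 0 < p.re) : ‖(p - 1) / (p + 1)‖ < 1 := by
  have h0 : 0 < ‖p + 1‖ := norm_pos_iff.2 fun h => by
    have := congrArg Complex.re h; simp at this; linarith
  rw [norm_div, div_lt_one h0]
  refine lt_of_pow_lt_pow_left₀ 2 h0.le ?_
  rw [← Complex.normSq_eq_norm_sq, ← Complex.normSq_eq_norm_sq, Complex.normSq_apply,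
    Complex.normSq_apply]
  simp
  nlinarith

theorem add_one_ne_zero_of_re_pos {p : ℂ} (hp : 0 < p.re) : p + 1 ≠ 0 := fun h => by
  have := congrArg Complex.re h; simp at this; linarith

/-- The Cayley transform `(p - 1)/(p + 1)` maps the disk into itself, fixes 0 and has derivative `c
1 / 2` there; the Schwarz lemma finishes. -/
theorem HasDiskSeries.norm_coeff_one_le {p : ℂ → ℂ} {c : ℕ → ℂ} (h : HasDiskSeries p c)
    (h0 : c 0 = 1) (hp : ∀ z ∈ Metric.ball (0 : ℂ) 1, 0 < (p z).re) : ‖c 1‖ ≤ 2 := by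
  have hd := h.differentiableOn
  have hp0 : p 0 = 1 := h.apply_zero.trans h0
  have hD : HasDerivAt p (c 1) 0 := by
    rw [← h.deriv_zero]
    exact (hd.differentiableAt (Metric.ball_mem_nhds _ one_pos)).hasDerivAt
  have hu : HasDerivAt (fun z => (p z - 1) / (p z + 1)) (c 1 / 2) 0 := by
    convert! (hD.sub_const 1).div (hD.add_const 1) (by rw [hp0]; norm_num) using 1
    rw [hp0]; ring
  have hud : DifferentiableOn ℂ (fun z => (p z - 1) / (p z + 1)) (Metric.ball 0 1) :=
    (hd.sub_const 1).div (hd.add_const 1) fun z hz => add_one_ne_zero_of_re_pos (hp z hz)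
  have := Complex.norm_deriv_le_one_of_mapsTo_ball hud (fun z hz => by
    simpa [hp0] using (norm_sub_one_div_add_one_lt (hp z hz)).le) one_pos
  rw [hu.deriv, norm_div] at this
  norm_num at this
  linarith

/-- Averaging `p` over the points `ω^j x`, with `ω` a primitive `n`-th root of unity and `x^n = y`,
keeps only the exponents divisible by `n` and preserves the positive real part. This reduces the
bound on the `n`-th coefficient to the bound on the first. -/
theorem HasDiskSeries.exists_section {p : ℂ → ℂ} {c : ℕ → ℂ} (h : HasDiskSeries p c)
    {n : ℕ} (hn : n ≠ 0) (hp : ∀ z ∈ Metric.ball (0 : ℂ) 1, 0 < (p z).re) :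
    ∃ q : ℂ → ℂ, HasDiskSeries q (fun k => c (k * n)) ∧
      ∀ z ∈ Metric.ball (0 : ℂ) 1, 0 < (q z).re := by
  have key : ∀ y ∈ Metric.ball (0 : ℂ) 1, ∃ v : ℂ, 0 < v.re ∧
      HasSum (fun k => c (k * n) * y ^ k) v := by
    intro y hy
    obtain ⟨x, hx⟩ := IsAlgClosed.exists_pow_nat_eq y (Nat.pos_of_ne_zero hn)
    have hx1 : ‖x‖ < 1 := by
      have : ‖x‖ ^ n < 1 := by rw [← norm_pow, hx]; simpa using hy
      exact (pow_lt_one_iff_of_nonneg (norm_nonneg _) hn).1 this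
    obtain ⟨ω, hω⟩ : ∃ ω : ℂ, IsPrimitiveRoot ω n := ⟨_, Complex.isPrimitiveRoot_exp n hn⟩
    have hmem : ∀ j : ℕ, ω ^ j * x ∈ Metric.ball (0 : ℂ) 1 := fun j => by
      simpa [hω.norm'_eq_one hn] using hx1
    have hs := hasSum_sum (s := Finset.range n) fun j _ => h _ (hmem j)
    have hterm : ∀ m, ∑ j ∈ Finset.range n, c m * (ω ^ j * x) ^ m =
        if n ∣ m then n * (c m * x ^ m) else 0 := by
      intro m
      have : ∀ j ∈ Finset.range n, c m * (ω ^ j * x) ^ m = (c m * x ^ m) * (ω ^ m) ^ j := by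
        intro j _
        rw [mul_pow, ← pow_mul, ← pow_mul, mul_comm j m]; ring
      rw [Finset.sum_congr rfl this, ← Finset.mul_sum]
      split_ifs with hm
      · rw [(hω.pow_eq_one_iff_dvd m).2 hm]; simp; ring
      · have h1 : ω ^ m ≠ 1 := fun h => hm ((hω.pow_eq_one_iff_dvd m).1 h)
        have h2 := mul_geom_sum (ω ^ m) n
        rw [← pow_mul, mul_comm m n, pow_mul, hω.pow_eq_one, one_pow, sub_self] at h2
        rw [(mul_eq_zero.1 h2).resolve_left (sub_ne_zero.2 h1), mul_zero]
    simp only [hterm] at hs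
    have hinj : Function.Injective (fun k : ℕ => k * n) := fun a b hab =>
      Nat.eq_of_mul_eq_mul_right (Nat.pos_of_ne_zero hn) hab
    rw [← hinj.hasSum_iff (fun m hm => if_neg fun ⟨k, hk⟩ => hm ⟨k, by simp [hk, mul_comm]⟩)] at hs
    have hs2 := hs.mul_left (n : ℂ)⁻¹
    have hn' : (n : ℂ) ≠ 0 := Nat.cast_ne_zero.2 hn
    refine ⟨(n : ℂ)⁻¹ * ∑ j ∈ Finset.range n, p (ω ^ j * x), ?_, ?_⟩
    · rw [← Complex.ofReal_natCast, ← Complex.ofReal_inv, Complex.re_ofReal_mul, Complex.re_sum]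
      refine mul_pos (by positivity) (Finset.sum_pos (fun j _ => hp _ (hmem j)) ?_)
      simpa using hn
    · convert! hs2 using 2 with k
      simp only [Function.comp_apply, dvd_mul_left, if_true]
      rw [inv_mul_cancel_left₀ hn', mul_comm k n, pow_mul, hx]
  choose! q hq using key
  exact ⟨q, fun z hz => (hq z hz).2, fun z hz => (hq z hz).1⟩

/-- **Carathéodory's lemma**: the coefficients of an analytic function with positive real part,
normalized by `p 0 = 1`, are bounded by `2`. -/
theorem HasDiskSeries.norm_coeff_le_two {p : ℂ → ℂ} {c : ℕ → ℂ} (h : HasDiskSeries p c)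
    (h0 : c 0 = 1) (hp : ∀ z ∈ Metric.ball (0 : ℂ) 1, 0 < (p z).re) {n : ℕ} (hn : n ≠ 0) :
    ‖c n‖ ≤ 2 := by
  obtain ⟨q, hq, hq'⟩ := h.exists_section hn hp
  simpa using hq.norm_coeff_one_le (by simpa using h0) hq'

namespace HasDiskSeries

variable {f g : ℂ → ℂ} {c d : ℕ → ℂ}

theorem sub (hf : HasDiskSeries f c) (hg : HasDiskSeries g d) :
    HasDiskSeries (fun z => f z - g z) (fun n => c n - d n) := fun z hz => by
  simpa [sub_mul] using (hf z hz).sub (hg z hz)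

theorem one : HasDiskSeries (fun _ => 1) (fun n => if n = 0 then 1 else 0) := fun z _ => by
  simpa using hasSum_single (f := fun n : ℕ => (if n = 0 then 1 else 0) * z ^ n) 0
    (by simp +contextual)

theorem differentiableAt (h : HasDiskSeries f c) {z : ℂ} (hz : z ∈ Metric.ball (0 : ℂ) 1) :
    DifferentiableAt ℂ f z :=
  h.differentiableOn.differentiableAt (Metric.isOpen_ball.mem_nhds hz)

end HasDiskSeries

/-! ### Wirtinger calculus and reduction to analytic data. -/

section Wirtinger

variable {u g : ℂ → ℂ} {u' g' z : ℂ}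

theorem HasDerivAt.hasFDerivAt_mul_conj (hu : HasDerivAt u u' z) (hg : HasDerivAt g g' z) :
    HasFDerivAt (fun z => u z * conj (g z))
      (u z • ((Complex.conjCLE : ℂ →L[ℝ] ℂ).comp
          ((ContinuousLinearMap.toSpanSingleton ℂ g').restrictScalars ℝ)) +
        conj (g z) • ((ContinuousLinearMap.toSpanSingleton ℂ u').restrictScalars ℝ)) z := by
  have h1 : HasFDerivAt u ((ContinuousLinearMap.toSpanSingleton ℂ u').restrictScalars ℝ) z :=
    hu.hasFDerivAt.restrictScalars ℝ
  have h2 : HasFDerivAt g ((ContinuousLinearMap.toSpanSingleton ℂ g').restrictScalars ℝ) z :=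
    hg.hasFDerivAt.restrictScalars ℝ
  have h3 : HasFDerivAt (fun z => conj (g z)) ((Complex.conjCLE : ℂ →L[ℝ] ℂ).comp
      ((ContinuousLinearMap.toSpanSingleton ℂ g').restrictScalars ℝ)) z :=
    Complex.conjCLE.hasFDerivAt.comp z h2
  exact h1.mul h3

theorem wirtingerZ_mul_conj (hu : HasDerivAt u u' z) (hg : HasDerivAt g g' z) :
    wirtingerZ (fun z => u z * conj (g z)) z = u' * conj (g z) := by
  rw [wirtingerZ, (hu.hasFDerivAt_mul_conj hg).fderiv]
  simp
  linear_combination ((u z * conj g' - conj (g z) * u') / 2) * Complex.I_sq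

theorem wirtingerZBar_mul_conj (hu : HasDerivAt u u' z) (hg : HasDerivAt g g' z) :
    wirtingerZBar (fun z => u z * conj (g z)) z = u z * conj g' := by
  rw [wirtingerZBar, (hu.hasFDerivAt_mul_conj hg).fderiv]
  simp
  linear_combination (-(u z * conj g' - conj (g z) * u') / 2) * Complex.I_sq

end Wirtinger

/-- Wirtinger derivatives are local. -/
theorem Filter.EventuallyEq.wirtinger_eq {f g : ℂ → ℂ} {z : ℂ} (h : f =ᶠ[nhds z] g) :
    wirtingerZ f z = wirtingerZ g z ∧ wirtingerZBar f z = wirtingerZBar g z := by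
  simp [wirtingerZ, wirtingerZBar, h.fderiv_eq]

/-- The logarithm of a function of the form `IsExpSeries`. -/
theorem IsExpSeries.exists_log {h : ℂ → ℂ} {a : ℕ → ℂ} (hh : IsExpSeries h a) :
    ∃ A : ℂ → ℂ, HasDiskSeries A (fun n => if n = 0 then 0 else a n) ∧
      ∀ z ∈ Metric.ball (0 : ℂ) 1, h z = Complex.exp (A z) := by
  refine ⟨fun z => ∑' n : ℕ, a (n + 1) * z ^ (n + 1), fun z hz => ?_, fun z hz => (hh z hz).2⟩
  rw [← hasSum_nat_add_iff' 1]
  simpa using (hh z hz).1.hasSum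

/-- `f = z exp (A) conj (exp (B))` on the disk with `A`, `B` analytic and vanishing at `0`, such
that `z B' = w (1 + z A')` for a Schwarz function `w`, and `1 + z A' - z B'` has positive real
part. -/
structure LogHarmonicData (f A B w : ℂ → ℂ) (α β : ℕ → ℂ) : Prop where
  eq_exp : ∀ z ∈ Metric.ball (0 : ℂ) 1, f z = z * Complex.exp (A z) * conj (Complex.exp (B z))
  seriesA : HasDiskSeries A α
  seriesB : HasDiskSeries B β
  alpha_zero : α 0 = 0
  beta_zero : β 0 = 0
  w_diff : DifferentiableOn ℂ w (Metric.ball 0 1)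
  w_norm_lt : ∀ z ∈ Metric.ball (0 : ℂ) 1, ‖w z‖ < 1
  w_norm_le : ∀ z ∈ Metric.ball (0 : ℂ) 1, ‖w z‖ ≤ ‖z‖
  w_eq : ∀ z ∈ Metric.ball (0 : ℂ) 1, z * deriv B z = w z * (1 + z * deriv A z)
  re_pos : ∀ z ∈ Metric.ball (0 : ℂ) 1, 0 < (1 + z * deriv A z - z * deriv B z).re

/-- Here `z f_z / f = 1 + zA'` and `conj(f_z̄) / conj f = B'`. In the starlikeness condition the
term `conj(zB')` may be replaced by `zB'`, since only real parts matter; this makes the condition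
one on an analytic function. -/
theorem IsStarlikeLogHarmonic.exists_data {f h g : ℂ → ℂ} {a b : ℕ → ℂ}
    (hf : IsStarlikeLogHarmonic f) (hr : HasLogHarmonicRep f h g a b) :
    ∃ A B w : ℂ → ℂ, LogHarmonicData f A B w (fun n => if n = 0 then 0 else a n)
      (fun n => if n = 0 then 0 else b n) := by
  obtain ⟨A, hA, hAh⟩ := hr.analytic_factor.exists_log
  obtain ⟨B, hB, hBg⟩ := hr.coanalytic_factor.exists_log
  obtain ⟨w, hwd, hw1, hw⟩ := hf.logHarmonic.equation
  have hfe : ∀ z ∈ Metric.ball (0 : ℂ) 1,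
      f z = z * Complex.exp (A z) * conj (Complex.exp (B z)) := fun z hz => by
    rw [hr.eq_mul z hz, hAh z hz, hBg z hz]
  have hne : ∀ z ∈ Metric.ball (0 : ℂ) 1, z ≠ 0 → f z ≠ 0 := fun z hz hz0 => by
    rw [hfe z hz]; simp [hz0, Complex.exp_ne_zero]
  have hW : ∀ z ∈ Metric.ball (0 : ℂ) 1,
      wirtingerZ f z = (1 + z * deriv A z) * Complex.exp (A z) * conj (Complex.exp (B z)) ∧
      wirtingerZBar f z =
        z * Complex.exp (A z) * conj (deriv B z * Complex.exp (B z)) := fun z hz => by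
    have hev : f =ᶠ[nhds z] fun z => z * Complex.exp (A z) * conj (Complex.exp (B z)) := by
      filter_upwards [Metric.isOpen_ball.mem_nhds hz] with y hy using hfe y hy
    have hu : HasDerivAt (fun z => z * Complex.exp (A z))
        ((1 + z * deriv A z) * Complex.exp (A z)) z := by
      convert! (hasDerivAt_id z).mul (hA.differentiableAt hz).hasDerivAt.cexp using 1
      simp; ring
    have hg : HasDerivAt (fun z => Complex.exp (B z)) (deriv B z * Complex.exp (B z)) z := by
      convert! (hB.differentiableAt hz).hasDerivAt.cexp using 1
      ring
    rw [hev.wirtinger_eq.1, hev.wirtinger_eq.2, wirtingerZ_mul_conj hu hg,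
      wirtingerZBar_mul_conj hu hg]
    exact ⟨rfl, rfl⟩
  have hE : ∀ z, conj (Complex.exp (B z)) ≠ 0 := fun z => by simp [Complex.exp_ne_zero]
  have hE' : ∀ z, Complex.exp (A z) ≠ 0 := fun z => Complex.exp_ne_zero _
  have hweq' : ∀ z ∈ Metric.ball (0 : ℂ) 1, z ≠ 0 →
      z * deriv B z = w z * (1 + z * deriv A z) := fun z hz hz0 => by
    have h1 := hw z hz (hne z hz hz0)
    rw [(hW z hz).1, (hW z hz).2, hfe z hz] at h1
    have hcz : conj z ≠ 0 := by simpa using hz0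
    have hcA : conj (Complex.exp (A z)) ≠ 0 := by simp [Complex.exp_ne_zero]
    have h2 : conj (z * Complex.exp (A z) * conj (deriv B z * Complex.exp (B z))) /
        conj (z * Complex.exp (A z) * conj (Complex.exp (B z))) = deriv B z := by
      simp only [map_mul, Complex.conj_conj]
      field_simp [Complex.exp_ne_zero]
    rw [h2] at h1
    rw [h1]
    have := hE z
    field_simp [Complex.exp_ne_zero]
  have h0 : (0 : ℂ) ∈ Metric.ball (0 : ℂ) 1 := by simp
  have hA' := hA.id_mul_deriv
  have hB' := hB.id_mul_deriv
  -- The equation is known only off the origin; both sides are continuous, and at 0 it reads `0 = w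
  -- 0`.
  have hw0 : w 0 = 0 := by
    have c1 : ContinuousAt (fun z => z * deriv B z) 0 := (hB'.differentiableAt h0).continuousAt
    have c2 : ContinuousAt (fun z => w z * (1 + z * deriv A z)) 0 :=
      (hwd.differentiableAt (Metric.isOpen_ball.mem_nhds h0)).continuousAt.mul
        (continuousAt_const.add (hA'.differentiableAt h0).continuousAt)
    have := (c1.eventuallyEq_nhds_iff_eventuallyEq_nhdsNE c2).1 (by
      filter_upwards [self_mem_nhdsWithin, nhdsWithin_le_nhds (Metric.isOpen_ball.mem_nhds h0)]
        with z hz hz' using hweq' z hz' hz)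
    simpa using this.eq_of_nhds.symm
  refine ⟨A, B, w, hfe, hA, hB, rfl, rfl, hwd, hw1, fun z hz => ?_, fun z hz => ?_, fun z hz => ?_⟩
  · exact Complex.norm_le_norm_of_mapsTo_ball hwd (fun z hz => by simpa using (hw1 z hz).le) hw0
      (by simpa using hz)
  · rcases eq_or_ne z 0 with rfl | hz0
    · simp [hw0]
    · exact hweq' z hz hz0
  · rcases eq_or_ne z 0 with rfl | hz0
    · simp
    · have h1 := hf.re_pos z hz hz0
      have h2 : (z * wirtingerZ f z - conj z * wirtingerZBar f z) / f z =
          1 + z * deriv A z - conj (z * deriv B z) := by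
        rw [(hW z hz).1, (hW z hz).2, hfe z hz]
        have := hE z
        have := hE' z
        simp only [map_mul]
        field_simp
      rw [h2] at h1
      simpa using h1

/-! ### Coefficient bounds. -/

namespace LogHarmonicData

variable {f A B w : ℂ → ℂ} {α β : ℕ → ℂ} {z : ℂ}

theorem one_sub_w_ne_zero (h : LogHarmonicData f A B w α β) (hz : z ∈ Metric.ball (0 : ℂ) 1) :
    1 - w z ≠ 0 := fun h0 => by
  have := h.w_norm_lt z hz
  rw [← sub_eq_zero.1 h0] at this
  simp at this

/-- The function with positive real part `p = 1 + z A' - z B'` and the function `q = 1 / (1 - w)`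
determine the logarithmic derivatives. -/
theorem one_add_eq (h : LogHarmonicData f A B w α β) (hz : z ∈ Metric.ball (0 : ℂ) 1) :
    1 + z * deriv A z = (1 + z * deriv A z - z * deriv B z) * (1 / (1 - w z)) := by
  have := h.one_sub_w_ne_zero hz
  rw [h.w_eq z hz]
  field_simp

theorem id_mul_deriv_eq (h : LogHarmonicData f A B w α β) (hz : z ∈ Metric.ball (0 : ℂ) 1) :
    z * deriv B z = (1 + z * deriv A z - z * deriv B z) * (1 / (1 - w z) - 1) := by
  have := h.one_sub_w_ne_zero hz
  rw [h.w_eq z hz]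
  field_simp
  ring

theorem exists_series (h : LogHarmonicData f A B w α β) :
    ∃ P Q : ℕ → ℂ, P 0 = 1 ∧ Q 0 = 1 ∧ (∀ n ≠ 0, ‖P n‖ ≤ 2) ∧ (∀ n ≠ 0, ‖Q n‖ ≤ 1) ∧
      (∀ n : ℕ, n ≠ 0 → (n : ℂ) * α n = ∑ x ∈ Finset.HasAntidiagonal.antidiagonal n, P x.1 * Q x.2) ∧
      ∀ n : ℕ, (n : ℂ) * β n =
        ∑ x ∈ Finset.HasAntidiagonal.antidiagonal n, P x.1 * (if x.2 = 0 then 0 else Q x.2) := by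
  have hA := h.seriesA.id_mul_deriv
  have hB := h.seriesB.id_mul_deriv
  have hp := (HasDiskSeries.one.add hA).sub hB
  have hqd : DifferentiableOn ℂ (fun z => 1 / (1 - w z)) (Metric.ball 0 1) :=
    (differentiableOn_const 1).div ((differentiableOn_const 1).sub h.w_diff)
      fun z hz => h.one_sub_w_ne_zero hz
  have hq := HasDiskSeries.of_differentiableOn hqd
  generalize hQ : (fun n : ℕ => (n.factorial : ℂ)⁻¹ *
    iteratedDeriv n (fun z => 1 / (1 - w z)) 0) = Q at hq
  have h0 : (0 : ℂ) ∈ Metric.ball (0 : ℂ) 1 := by simp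
  have hw0 : w 0 = 0 := by simpa using h.w_norm_le 0 h0
  have hQ0 : Q 0 = 1 := by rw [← hq.apply_zero]; simp [hw0]
  refine ⟨_, Q, ?_, hQ0, fun n hn => hp.norm_coeff_le_two ?_ h.re_pos hn, fun n hn => ?_,
    fun n hn => ?_, fun n => ?_⟩
  · simp
  · simp
  · have h2 := (hq.add hq).sub HasDiskSeries.one
    have h3 := h2.norm_coeff_le_two (by simp [hQ0]) (fun z hz => ?_) hn
    · simp only [hn, if_false, sub_zero, ← two_mul, norm_mul] at h3
      norm_num at h3
      exact h3
    · have hw := h.w_norm_lt z hz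
      have e : 1 / (1 - w z) + 1 / (1 - w z) - 1 = (1 + w z) / (1 - w z) := by
        have := h.one_sub_w_ne_zero hz
        field_simp
        ring
      have hw2 : ‖w z‖ ^ 2 < 1 := by nlinarith [norm_nonneg (w z)]
      rw [← Complex.normSq_eq_norm_sq, Complex.normSq_apply] at hw2
      rw [e, Complex.div_re, ← add_div]
      refine div_pos ?_ (Complex.normSq_pos.2 (h.one_sub_w_ne_zero hz))
      simp
      nlinarith
  · have := (hp.mul hq).congr (g := fun z => 1 + z * deriv A z)
      fun z hz => (h.one_add_eq hz).symm
    have := congrFun ((HasDiskSeries.one.add hA).unique this) n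
    simpa [hn] using this
  · have := (hp.mul (hq.sub HasDiskSeries.one)).congr (g := fun z => z * deriv B z)
      fun z hz => (h.id_mul_deriv_eq hz).symm
    rw [congrFun (hB.unique this) n]
    refine Finset.sum_congr rfl fun x _ => ?_
    congr 1
    split_ifs with hx
    · rw [hx, hQ0, sub_self]
    · rw [sub_zero]

/-- In the convolution for `n α n` the term `P 0 * Q n` is at most 1 and the other `n` terms are at
most 2. -/
theorem norm_alpha_le (h : LogHarmonicData f A B w α β) {n : ℕ} (hn : n ≠ 0) :
    ‖α n‖ ≤ 2 + 1 / n := by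
  obtain ⟨P, Q, hP0, hQ0, hP, hQ, hα, -⟩ := h.exists_series
  have hn' : (0 : ℝ) < n := by positivity
  have hQ1 : ∀ m, ‖Q m‖ ≤ 1 := fun m => by
    rcases eq_or_ne m 0 with rfl | hm
    · simp [hQ0]
    · exact hQ m hm
  have h1 : ‖(n : ℂ) * α n‖ ≤ 2 * n + 1 := by
    rw [hα n hn, Finset.Nat.sum_antidiagonal_eq_sum_range_succ (fun i j => P i * Q j),
      Finset.sum_range_succ']
    refine (norm_add_le _ _).trans (add_le_add ?_ ?_)
    · refine (norm_sum_le_of_le (n := fun _ => 2) _ fun i _ => ?_).trans (by simp [mul_comm])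
      rw [norm_mul]
      nlinarith [hP (i + 1) (by simp), hQ1 (n - (i + 1)), norm_nonneg (P (i + 1)),
        norm_nonneg (Q (n - (i + 1)))]
    · simpa [hP0] using hQ1 n
  rw [norm_mul, Complex.norm_natCast] at h1
  have : (2 + 1 / n : ℝ) = (2 * n + 1) / n := by field_simp
  rw [this, le_div_iff₀ hn']
  linarith

/-- Replacing `q` by `q - 1` removes the term `P n * Q 0`, so the total drops from `2n + 1` to `2n -
1`. -/
theorem norm_beta_le (h : LogHarmonicData f A B w α β) {n : ℕ} (hn : n ≠ 0) :
    ‖β n‖ ≤ 2 - 1 / n := by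
  obtain ⟨P, Q, hP0, hQ0, hP, hQ, -, hβ⟩ := h.exists_series
  obtain ⟨m, rfl⟩ := Nat.exists_eq_succ_of_ne_zero hn
  have hn' : (0 : ℝ) < (m + 1 : ℕ) := by positivity
  have hQ1 : ∀ k, ‖(if k = 0 then 0 else Q k)‖ ≤ 1 := fun k => by
    split_ifs with hk
    · simp
    · exact hQ k hk
  have h1 : ‖((m + 1 : ℕ) : ℂ) * β (m + 1)‖ ≤ 2 * m + 1 := by
    rw [hβ, Finset.Nat.sum_antidiagonal_eq_sum_range_succ
      (fun i j => P i * (if j = 0 then 0 else Q j)), Finset.sum_range_succ, Finset.sum_range_succ']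
    simp only [Nat.sub_self, if_true, mul_zero, add_zero]
    refine (norm_add_le _ _).trans (add_le_add ?_ ?_)
    · refine (norm_sum_le_of_le (n := fun _ => 2) _ fun i _ => ?_).trans (by simp [mul_comm])
      rw [norm_mul]
      nlinarith [hP (i + 1) (by simp), hQ1 (m + 1 - (i + 1)), norm_nonneg (P (i + 1)),
        norm_nonneg (if m + 1 - (i + 1) = 0 then 0 else Q (m + 1 - (i + 1)))]
    · simpa [hP0] using hQ (m + 1) (by simp)
  rw [norm_mul, Complex.norm_natCast] at h1
  have : (2 - 1 / (m + 1 : ℕ) : ℝ) = (2 * m + 1) / (m + 1 : ℕ) := by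
    field_simp; push_cast; ring
  rw [this, le_div_iff₀ hn']
  linarith

end LogHarmonicData

/-! ### The growth theorem. -/

/-- If `‖w‖ ≤ r < 1`, then `(1 + w) / (1 - w)` has real part at least `(1 - r) / (1 + r)`. -/
theorem div_le_re_one_add_div_one_sub {w : ℂ} {r : ℝ} (hw : ‖w‖ ≤ r) (hr : r < 1) :
    (1 - r) / (1 + r) ≤ ((1 + w) / (1 - w)).re := by
  have hr0 : 0 ≤ r := (norm_nonneg w).trans hw
  have hw2 : w.re ^ 2 + w.im ^ 2 = ‖w‖ ^ 2 := by
    rw [← Complex.normSq_eq_norm_sq, Complex.normSq_apply]; ring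
  have hre := Complex.abs_re_le_norm w
  have hre' : |w.re| ≤ r := hre.trans hw
  have hne : 0 < Complex.normSq (1 - w) := Complex.normSq_pos.2 fun h0 => by
    rw [← sub_eq_zero.1 h0] at hw; simp at hw; linarith
  rw [Complex.div_re, ← add_div, div_le_div_iff₀ (by linarith) hne, Complex.normSq_apply]
  simp
  have h2 : ‖w‖ ^ 2 ≤ r ^ 2 := by gcongr
  nlinarith [abs_le.1 hre', mul_nonneg hr0 (sub_nonneg.2 (abs_le.1 hre').1)]

/-- If `p` is analytic with positive real part in the disk and `p 0 = 1`, then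
`Re (1 / p) ≤ (1 + |z|) / (1 - |z|)`. -/
theorem re_inv_le_of_re_pos {p : ℂ → ℂ} (hd : DifferentiableOn ℂ p (Metric.ball 0 1))
    (h0 : p 0 = 1) (hp : ∀ z ∈ Metric.ball (0 : ℂ) 1, 0 < (p z).re) {z : ℂ}
    (hz : z ∈ Metric.ball (0 : ℂ) 1) : ((p z)⁻¹).re ≤ (1 + ‖z‖) / (1 - ‖z‖) := by
  have hz1 : ‖z‖ < 1 := by simpa using hz
  have hud : DifferentiableOn ℂ (fun z => (p z - 1) / (p z + 1)) (Metric.ball 0 1) :=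
    (hd.sub_const 1).div (hd.add_const 1) fun z hz => add_one_ne_zero_of_re_pos (hp z hz)
  have hu : ‖(p z - 1) / (p z + 1)‖ ≤ ‖z‖ :=
    Complex.norm_le_norm_of_mapsTo_ball hud (fun z hz => by
      simpa using (norm_sub_one_div_add_one_lt (hp z hz)).le) (by simp [h0]) hz1
  have hp0 : p z ≠ 0 := fun h => by simpa [h] using hp z hz
  have hp1 := add_one_ne_zero_of_re_pos (hp z hz)
  set u := (p z - 1) / (p z + 1) with hudef
  have e1 : 1 + u = 2 * p z / (p z + 1) := by rw [hudef]; field_simp; ring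
  have e2 : 1 - u = 2 / (p z + 1) := by rw [hudef]; field_simp; ring
  have e : (p z)⁻¹ = (1 - u) / (1 + u) := by rw [e1, e2]; field_simp
  refine (Complex.re_le_norm _).trans ?_
  rw [e, norm_div]
  have h1 : 1 - ‖z‖ ≤ ‖1 + u‖ := by
    have := norm_sub_le (1 + u) u
    simp only [add_sub_cancel_right, norm_one] at this
    linarith
  have h2 : ‖1 - u‖ ≤ 1 + ‖z‖ := (norm_sub_le _ _).trans (by simpa using hu)
  exact div_le_div₀ (by positivity) h2 (by linarith) h1

theorem hasDerivAt_norm_one_sub_mul (κ : ℂ) :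
    HasDerivAt (fun t : ℝ => ‖1 - t * κ‖) (-κ.re) 0 := by
  have h1 : HasDerivAt (fun t : ℝ => (1 - t * κ.re) ^ 2 + (t * κ.im) ^ 2) (-2 * κ.re) 0 := by
    have ha : HasDerivAt (fun t : ℝ => 1 - t * κ.re) (-κ.re) 0 := by
      simpa using ((hasDerivAt_id (0 : ℝ)).mul_const κ.re).const_sub 1
    have hb : HasDerivAt (fun t : ℝ => t * κ.im) κ.im 0 := by
      simpa using (hasDerivAt_id (0 : ℝ)).mul_const κ.im
    convert! (ha.pow 2).add (hb.pow 2) using 1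
    simp
  have h2 := h1.sqrt (by simp)
  convert! h2 using 1
  · ext t
    rw [Complex.norm_def, Complex.normSq_apply]
    congr 1
    simp
    ring
  · simp
    ring

/-- A function with negative derivative at `0` takes smaller values immediately to the right. -/
theorem HasDerivAt.eventually_lt_of_neg {φ : ℝ → ℝ} {D : ℝ} (h : HasDerivAt φ D 0) (hD : D < 0) :
    ∀ᶠ t in nhdsWithin (0 : ℝ) (Set.Ioi 0), φ t < φ 0 := by
  have h1 := (hasDerivAt_iff_tendsto_slope.1 h).mono_left
    (nhdsWithin_mono (0 : ℝ) (fun t (ht : 0 < t) => ht.ne'))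
  filter_upwards [h1.eventually_lt_const hD, self_mem_nhdsWithin] with t ht ht0
  rw [slope_def_field, sub_zero, div_lt_iff₀ ht0] at ht
  linarith

namespace LogHarmonicData

variable {f A B w : ℂ → ℂ} {α β : ℕ → ℂ} {z : ℂ}

/-- The perturbed growth functional. -/
noncomputable def growthFun (A B : ℂ → ℂ) (ε : ℝ) (z : ℂ) : ℝ :=
  (A z + B z).re + 4 - 4 / (1 + ‖z‖) + ε * ‖z‖

theorem hasDerivAt_growthFun (h : LogHarmonicData f A B w α β)
    (hz : z ∈ Metric.ball (0 : ℂ) 1) (ε : ℝ) (κ : ℂ) :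
    HasDerivAt (fun t : ℝ => growthFun A B ε (z * (1 - t * κ)))
      (-(κ * (z * deriv A z + z * deriv B z)).re - 4 * (‖z‖ * κ.re) / (1 + ‖z‖) ^ 2 -
        ε * (‖z‖ * κ.re)) 0 := by
  have hpath : HasDerivAt (fun t : ℝ => z * (1 - t * κ)) (-(z * κ)) 0 := by
    have : HasDerivAt (fun t : ℝ => (t : ℂ)) 1 0 := Complex.ofRealCLM.hasDerivAt
    simpa using ((this.mul_const κ).const_sub 1).const_mul z
  have e0 : z * (1 - (0 : ℝ) * κ) = z := by simp
  have hAB : HasDerivAt (fun y => A y + B y) (deriv A z + deriv B z) (z * (1 - (0 : ℝ) * κ)) := by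
    rw [e0]
    exact (h.seriesA.differentiableAt hz).hasDerivAt.add (h.seriesB.differentiableAt hz).hasDerivAt
  have hcomp : HasDerivAt (fun t : ℝ => A (z * (1 - t * κ)) + B (z * (1 - t * κ)))
      ((deriv A z + deriv B z) * (-(z * κ))) 0 := by
    simpa using! HasDerivAt.comp (0 : ℝ) hAB hpath
  have hre : HasDerivAt (fun t : ℝ => (A (z * (1 - t * κ)) + B (z * (1 - t * κ))).re)
      ((deriv A z + deriv B z) * (-(z * κ))).re 0 :=
    Complex.reCLM.hasFDerivAt.comp_hasDerivAt 0 hcomp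
  have hn : HasDerivAt (fun t : ℝ => ‖z * (1 - t * κ)‖) (‖z‖ * -κ.re) 0 := by
    simpa only [norm_mul] using (hasDerivAt_norm_one_sub_mul κ).const_mul ‖z‖
  have hd : HasDerivAt (fun t : ℝ => 4 / (1 + ‖z * (1 - t * κ)‖))
      (4 * (‖z‖ * κ.re) / (1 + ‖z‖) ^ 2) 0 := by
    convert! (hasDerivAt_const (0 : ℝ) (4 : ℝ)).div (hn.const_add 1) (by positivity) using 1
    simp
  convert! ((hre.add_const 4).sub hd).add (hn.const_mul ε) using 1
  simp
  ring

theorem p_differentiableOn (h : LogHarmonicData f A B w α β) :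
    DifferentiableOn ℂ (fun z => 1 + z * deriv A z - z * deriv B z) (Metric.ball 0 1) :=
  ((HasDiskSeries.one.add h.seriesA.id_mul_deriv).sub h.seriesB.id_mul_deriv).differentiableOn

/-- The functional vanishes at 0, so it suffices to exclude a minimum at `y ≠ 0` on a closed disk.
Move along `y (1 - t/p)`: initially `log f` has the real velocity `-Re((1 + w)/(1 - w))`, so `f`
heads straight for the origin, while `|y|` decreases and the path stays in the disk. The functional
decreases strictly along it, with `ε` supplying the strictness. -/
theorem growthFun_nonneg (h : LogHarmonicData f A B w α β) {ε : ℝ} (hε : 0 < ε)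
    (hz : z ∈ Metric.ball (0 : ℂ) 1) : 0 ≤ growthFun A B ε z := by
  have hz1 : ‖z‖ < 1 := by simpa using hz
  have hsub : Metric.closedBall (0 : ℂ) ‖z‖ ⊆ Metric.ball 0 1 := Metric.closedBall_subset_ball hz1
  have hcont : ContinuousOn (growthFun A B ε) (Metric.closedBall 0 ‖z‖) := by
    have h1 : ContinuousOn (fun z => (A z + B z).re) (Metric.closedBall 0 ‖z‖) :=
      Complex.continuous_re.comp_continuousOn
        ((h.seriesA.add h.seriesB).differentiableOn.continuousOn.mono hsub)
    have h2 : Continuous fun z : ℂ => 4 / (1 + ‖z‖) :=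
      continuous_const.div (by fun_prop) fun z => by positivity
    exact ((h1.add continuousOn_const).sub h2.continuousOn).add (by fun_prop)
  obtain ⟨y, hy, hmin⟩ := (isCompact_closedBall (0 : ℂ) ‖z‖).exists_isMinOn ⟨0, by simp⟩ hcont
  have hyz : growthFun A B ε y ≤ growthFun A B ε z := hmin (by simp)
  have hy1 : y ∈ Metric.ball (0 : ℂ) 1 := hsub hy
  have hyn : ‖y‖ < 1 := by simpa using hy1
  rcases eq_or_ne y 0 with rfl | hy0
  · refine le_trans ?_ hyz
    simp [growthFun, h.seriesA.apply_zero, h.seriesB.apply_zero, h.alpha_zero, h.beta_zero]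
  exfalso
  set p := 1 + y * deriv A y - y * deriv B y with hpdef
  have hp : 0 < p.re := h.re_pos y hy1
  have hp0 : p ≠ 0 := fun h => by simp [h] at hp
  have hκ : 0 < (p⁻¹).re := by
    rw [Complex.inv_re]
    exact div_pos hp (Complex.normSq_pos.2 hp0)
  have hκ' : (p⁻¹).re ≤ (1 + ‖y‖) / (1 - ‖y‖) :=
    re_inv_le_of_re_pos h.p_differentiableOn (by simp) h.re_pos hy1
  have hq := div_le_re_one_add_div_one_sub (h.w_norm_le y hy1) hyn
  have hr0 : 0 < ‖y‖ := norm_pos_iff.2 hy0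
  have hsum : p⁻¹ * (y * deriv A y + y * deriv B y) = (1 + w y) / (1 - w y) - p⁻¹ := by
    have h1 := h.one_add_eq hy1
    have h2 := h.id_mul_deriv_eq hy1
    rw [← hpdef] at h1 h2
    have h3 := h.one_sub_w_ne_zero hy1
    have h4 : y * deriv A y = p * (1 / (1 - w y)) - 1 := by rw [← h1]; ring
    rw [h2, h4]
    field_simp
    ring
  have hD := h.hasDerivAt_growthFun hy1 ε p⁻¹
  have hneg : -(p⁻¹ * (y * deriv A y + y * deriv B y)).re -
      4 * (‖y‖ * (p⁻¹).re) / (1 + ‖y‖) ^ 2 - ε * (‖y‖ * (p⁻¹).re) < 0 := by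
    rw [hsum, Complex.sub_re]
    have h5 : 0 < ε * (‖y‖ * (p⁻¹).re) := by positivity
    -- The comparison function `log r - 4r/(1+r)` has derivative `((1-r)/(1+r))²` with respect to
    -- `log r`, which explains the square.
    have h6 : (p⁻¹).re * ((1 - ‖y‖) / (1 + ‖y‖)) ^ 2 ≤ (1 - ‖y‖) / (1 + ‖y‖) := by
      have h7 : 0 < 1 - ‖y‖ := by linarith
      calc _ ≤ (1 + ‖y‖) / (1 - ‖y‖) * ((1 - ‖y‖) / (1 + ‖y‖)) ^ 2 := by gcongr
        _ = _ := by field_simp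
    have h8 : (p⁻¹).re * ((1 - ‖y‖) / (1 + ‖y‖)) ^ 2 =
        (p⁻¹).re - 4 * (‖y‖ * (p⁻¹).re) / (1 + ‖y‖) ^ 2 := by
      field_simp
      ring
    linarith
  have hN := ((hasDerivAt_norm_one_sub_mul p⁻¹).eventually_lt_of_neg (by linarith)).and
    (hD.eventually_lt_of_neg hneg)
  obtain ⟨t, ht1, ht2⟩ := hN.exists
  simp only [Complex.ofReal_zero, zero_mul, sub_zero, norm_one, mul_one] at ht1 ht2
  refine absurd ht2 (not_lt.2 (hmin ?_))
  have hy' : ‖y‖ ≤ ‖z‖ := by simpa using hy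
  rw [mem_closedBall_zero_iff, norm_mul]
  nlinarith

/-- The growth theorem for starlike log-harmonic mappings. -/
theorem le_norm (h : LogHarmonicData f A B w α β) (hz : z ∈ Metric.ball (0 : ℂ) 1) :
    ‖z‖ * Real.exp (-(4 * ‖z‖ / (1 + ‖z‖))) ≤ ‖f z‖ := by
  have h1 : 0 ≤ growthFun A B 0 z := by
    have hlim : Filter.Tendsto (fun ε : ℝ => growthFun A B ε z) (nhdsWithin 0 (Set.Ioi 0))
        (nhds (growthFun A B 0 z)) := by
      have : Continuous fun ε : ℝ => growthFun A B ε z := by unfold growthFun; fun_prop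
      exact (this.tendsto 0).mono_left nhdsWithin_le_nhds
    refine ge_of_tendsto hlim ?_
    filter_upwards [self_mem_nhdsWithin] with ε hε using h.growthFun_nonneg hε hz
  rw [h.eq_exp z hz, norm_mul, norm_mul, RCLike.norm_conj, Complex.norm_exp, Complex.norm_exp,
    mul_assoc, ← Real.exp_add]
  gcongr
  have e : 4 * ‖z‖ / (1 + ‖z‖) = 4 - 4 / (1 + ‖z‖) := by field_simp; ring
  simp only [growthFun, Complex.add_re, zero_mul, add_zero] at h1
  rw [e]
  linarith

end LogHarmonicData

/-! ### Openness of the mapping and the covering theorem. -/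

namespace LogHarmonicData

variable {f A B w : ℂ → ℂ} {α β : ℕ → ℂ} {z : ℂ}

/-- The mapping is open near every point of the disk. -/
theorem nhds_le_map (h : LogHarmonicData f A B w α β) (hz : z ∈ Metric.ball (0 : ℂ) 1) :
    nhds (f z) ≤ Filter.map f (nhds z) := by
  have hAd := h.seriesA.differentiableOn
  have hBd := h.seriesB.differentiableOn
  have hnhds := Metric.isOpen_ball.mem_nhds hz
  have hu : HasDerivAt (fun z => z * Complex.exp (A z))
      ((1 + z * deriv A z) * Complex.exp (A z)) z := by
    convert! (hasDerivAt_id z).mul (h.seriesA.differentiableAt hz).hasDerivAt.cexp using 1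
    simp; ring
  have hg : HasDerivAt (fun z => Complex.exp (B z)) (deriv B z * Complex.exp (B z)) z := by
    convert! (h.seriesB.differentiableAt hz).hasDerivAt.cexp using 1
    ring
  have hL := hu.hasFDerivAt_mul_conj hg
  have hcd : ContDiffAt ℝ 1 (fun z => z * Complex.exp (A z) * conj (Complex.exp (B z))) z := by
    have hA' : ContDiffAt ℝ 1 A z :=
      ((hAd.contDiffOn Metric.isOpen_ball).contDiffAt hnhds).restrict_scalars ℝ
    have hB' : ContDiffAt ℝ 1 B z :=
      ((hBd.contDiffOn Metric.isOpen_ball).contDiffAt hnhds).restrict_scalars ℝ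
    exact (contDiffAt_id.mul hA'.cexp).mul
      (Complex.conjCLE.contDiff.contDiffAt.comp z hB'.cexp)
  have hs := hcd.hasStrictFDerivAt' hL one_ne_zero
  have hne : 1 + z * deriv A z ≠ 0 := by
    rw [h.one_add_eq hz]
    refine mul_ne_zero (fun h0 => ?_) (one_div_ne_zero (h.one_sub_w_ne_zero hz))
    simpa [h0] using h.re_pos z hz
  have hEA := Complex.exp_ne_zero (A z)
  have hEB := Complex.exp_ne_zero (B z)
  -- This is `|f_z̄| < |f_z|`, with ratio `|w|`. It makes the real differential `v ↦ f_z v + f_z̄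
  -- conj v` injective, hence surjective.
  have hlt : ‖z * Complex.exp (A z) * conj (deriv B z * Complex.exp (B z))‖ <
      ‖conj (Complex.exp (B z)) * ((1 + z * deriv A z) * Complex.exp (A z))‖ := by
    have e1 : ‖z * Complex.exp (A z) * conj (deriv B z * Complex.exp (B z))‖ =
        ‖w z‖ * (‖1 + z * deriv A z‖ * (‖Complex.exp (A z)‖ * ‖Complex.exp (B z)‖)) := by
      rw [← mul_assoc, ← norm_mul, ← h.w_eq z hz]
      simp only [norm_mul, RCLike.norm_conj]
      ring
    have e2 : ‖conj (Complex.exp (B z)) * ((1 + z * deriv A z) * Complex.exp (A z))‖ =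
        ‖1 + z * deriv A z‖ * (‖Complex.exp (A z)‖ * ‖Complex.exp (B z)‖) := by
      simp only [norm_mul, RCLike.norm_conj]
      ring
    rw [e1, e2]
    exact mul_lt_of_lt_one_left (by positivity) (h.w_norm_lt z hz)
  have hsurj := hs.map_nhds_eq_of_surj (by
    rw [LinearMap.range_eq_top]
    refine LinearMap.injective_iff_surjective.1 ((injective_iff_map_eq_zero _).2 fun v hv => ?_)
    by_contra hv0
    have hv1 : z * Complex.exp (A z) * conj (deriv B z * Complex.exp (B z)) * conj v =
        -(conj (Complex.exp (B z)) * ((1 + z * deriv A z) * Complex.exp (A z)) * v) := by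
      rw [eq_neg_iff_add_eq_zero, ← hv]
      simp
      ring
    have hv2 := congrArg norm hv1
    rw [norm_neg, norm_mul, norm_mul (_ * _) v, RCLike.norm_conj] at hv2
    exact hlt.ne (mul_right_cancel₀ (norm_ne_zero_iff.2 hv0) hv2))
  have hev : f =ᶠ[nhds z] fun z => z * Complex.exp (A z) * conj (Complex.exp (B z)) := by
    filter_upwards [hnhds] with y hy using h.eq_exp y hy
  rw [Filter.map_congr hev, hev.eq_of_nhds]
  exact hsurj.ge

theorem isOpen_image (h : LogHarmonicData f A B w α β) {U : Set ℂ} (hU : IsOpen U)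
    (hU1 : U ⊆ Metric.ball 0 1) : IsOpen (f '' U) := by
  rw [isOpen_iff_mem_nhds]
  rintro _ ⟨z, hz, rfl⟩
  exact h.nhds_le_map (hU1 hz) (Filter.image_mem_map (hU.mem_nhds hz))

theorem continuousOn (h : LogHarmonicData f A B w α β) : ContinuousOn f (Metric.ball 0 1) := by
  have hA := h.seriesA.differentiableOn.continuousOn
  have hB := h.seriesB.differentiableOn.continuousOn
  have : ContinuousOn (fun z => z * Complex.exp (A z) * conj (Complex.exp (B z)))
      (Metric.ball 0 1) :=
    (continuousOn_id.mul hA.cexp).mul (Complex.continuous_conj.comp_continuousOn hB.cexp)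
  exact this.congr h.eq_exp

/-- A univalent starlike log-harmonic mapping does not cover the plane. -/
theorem image_ne_univ (h : LogHarmonicData f A B w α β)
    (hinj : Set.InjOn f (Metric.ball 0 1)) : f '' Metric.ball 0 1 ≠ Set.univ := by
  -- By compactness some `f(|z| < R)` with `R < 1` would contain the closed disk of radius 2, so
  -- injectivity gives `|f| > 2` on `|z| = R`. There `|exp(-(A + B))| = R/|f| < 1/2`, yet this
  -- function equals 1 at 0, against the maximum principle.
  intro huniv
  let U : Set.Iio (1 : ℝ) → Set ℂ := fun R => f '' Metric.ball 0 R
  have hUo : ∀ R, IsOpen (U R) := fun R =>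
    h.isOpen_image Metric.isOpen_ball (Metric.ball_subset_ball R.2.le)
  have hmono : Monotone U := fun R S hRS => Set.image_mono (Metric.ball_subset_ball hRS)
  have : Nonempty (Set.Iio (1 : ℝ)) := ⟨⟨0, by simp⟩⟩
  obtain ⟨⟨R, hR1⟩, hR⟩ := (isCompact_closedBall (0 : ℂ) 2).elim_directed_cover U hUo
    (fun y _ => by
      obtain ⟨z, hz, rfl⟩ := huniv.symm ▸ Set.mem_univ y
      obtain ⟨R, hzR, hR⟩ := exists_between (mem_ball_zero_iff.1 hz)
      exact Set.mem_iUnion.2 ⟨⟨R, hR⟩, z, by simpa using hzR, rfl⟩) hmono.directed_le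
  have hR1 : R < 1 := hR1
  have hR0 : 0 < R := by
    obtain ⟨z, hz, -⟩ := hR (show (0 : ℂ) ∈ Metric.closedBall 0 2 by simp)
    exact Metric.pos_of_mem_ball hz
  have hbig : ∀ z : ℂ, ‖z‖ = R → 2 < ‖f z‖ := fun z hz => by
    by_contra hcon
    obtain ⟨y, hy, hyz⟩ := hR (show f z ∈ Metric.closedBall 0 2 by simpa using hcon)
    have hy' : ‖y‖ < R := by simpa using hy
    have : y = z := hinj (by simpa using hy'.trans hR1) (by simpa [hz] using hR1) hyz
    rw [this, hz] at hy'
    exact lt_irrefl _ hy'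
  have hdiff : DiffContOnCl ℂ (fun z => Complex.exp (-(A z + B z))) (Metric.ball 0 R) := by
    refine DifferentiableOn.diffContOnCl_ball (U := Metric.ball 0 1) ?_
      (Metric.closedBall_subset_ball hR1)
    exact (h.seriesA.add h.seriesB).differentiableOn.neg.cexp
  have hmax := Complex.norm_le_of_forall_mem_frontier_norm_le Metric.isBounded_ball hdiff
    (C := 1 / 2) (fun z hz => by
      rw [frontier_ball _ hR0.ne', mem_sphere_zero_iff_norm] at hz
      have h1 := hbig z hz
      rw [h.eq_exp z (by simpa [hz] using hR1), norm_mul, norm_mul, RCLike.norm_conj, mul_assoc,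
        ← norm_mul, ← Complex.exp_add, hz] at h1
      rw [Complex.exp_neg, norm_inv, one_div]
      refine inv_anti₀ two_pos ?_
      nlinarith [norm_nonneg (Complex.exp (A z + B z))])
    (subset_closure (Metric.mem_ball_self hR0))
  rw [h.seriesA.apply_zero, h.seriesB.apply_zero, h.alpha_zero, h.beta_zero] at hmax
  norm_num at hmax

/-- The covering theorem for starlike log-harmonic mappings: every boundary point of the image has
modulus at least `e⁻²`. -/
theorem exp_neg_two_le_norm (h : LogHarmonicData f A B w α β) {y : ℂ}
    (hy : y ∈ frontier (f '' Metric.ball 0 1)) : Real.exp (-2) ≤ ‖y‖ := by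
  obtain ⟨x, hx, hxy⟩ := mem_closure_iff_seq_limit.1 hy.1
  choose z hz hzx using hx
  obtain ⟨z₀, hz₀, φ, hφ, hlim⟩ := (isCompact_closedBall (0 : ℂ) 1).tendsto_subseq
    fun n => Metric.ball_subset_closedBall (hz n)
  have hxφ := hxy.comp hφ.tendsto_atTop
  -- A limit of preimages inside the disk would put `y` in the open image, so the limit lies on the
  -- unit circle and the growth bound tends to `e^{-2}`.
  rcases (mem_closedBall_zero_iff.1 hz₀).lt_or_eq with hlt | heq
  · exfalso
    have hz₀' : z₀ ∈ Metric.ball (0 : ℂ) 1 := by simpa using hlt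
    have hc := (h.continuousOn.continuousAt (Metric.isOpen_ball.mem_nhds hz₀')).tendsto.comp hlim
    have e : f ∘ z ∘ φ = x ∘ φ := funext fun n => hzx (φ n)
    rw [e] at hc
    rw [tendsto_nhds_unique hxφ hc] at hy
    refine hy.2 ?_
    rw [(h.isOpen_image Metric.isOpen_ball subset_rfl).interior_eq]
    exact ⟨z₀, hz₀', rfl⟩
  -- The absolute values keep the denominator positive, which gives continuity on all of `ℝ`.
  · have hcont : Continuous fun r : ℝ => |r| * Real.exp (-(4 * |r| / (1 + |r|))) := by
      refine continuous_abs.mul (Real.continuous_exp.comp (Continuous.neg ?_))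
      exact (by fun_prop : Continuous fun r : ℝ => 4 * |r|).div (by fun_prop)
        fun r => by positivity
    have hl := (hcont.tendsto 1).comp (heq ▸ hlim.norm)
    refine le_trans (le_of_eq ?_) (le_of_tendsto_of_tendsto' hl hxφ.norm fun n => ?_)
    · norm_num
    · simpa [← hzx (φ n)] using h.le_norm (hz (φ n))

theorem frontier_nonempty (h : LogHarmonicData f A B w α β)
    (hinj : Set.InjOn f (Metric.ball 0 1)) : (frontier (f '' Metric.ball 0 1)).Nonempty :=
  nonempty_frontier_iff.2 ⟨⟨f 0, 0, by simp, rfl⟩, h.image_ne_univ hinj⟩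

theorem exp_neg_two_le_distZeroBoundary (h : LogHarmonicData f A B w α β)
    (hinj : Set.InjOn f (Metric.ball 0 1)) : Real.exp (-2) ≤ distZeroBoundary f :=
  (Metric.le_infDist (h.frontier_nonempty hinj)).2 fun _ hy => by
    simpa using h.exp_neg_two_le_norm hy

/-- A sequence leaving every compact subset of the disk, whose images converge to `y`, yields a
boundary point of the image. -/
theorem mem_frontier_of_tendsto (h : LogHarmonicData f A B w α β)
    (hinj : Set.InjOn f (Metric.ball 0 1)) {x : ℕ → ℂ} {y : ℂ}
    (hx : ∀ n, x n ∈ Metric.ball (0 : ℂ) 1)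
    (hx1 : Filter.Tendsto (fun n => ‖x n‖) Filter.atTop (nhds 1))
    (hy : Filter.Tendsto (fun n => f (x n)) Filter.atTop (nhds y)) :
    y ∈ frontier (f '' Metric.ball 0 1) := by
  refine ⟨mem_closure_of_tendsto hy (Filter.Eventually.of_forall fun n => ⟨_, hx n, rfl⟩), ?_⟩
  rw [(h.isOpen_image Metric.isOpen_ball subset_rfl).interior_eq]
  rintro ⟨z, hz, rfl⟩
  obtain ⟨R, hzR, hR⟩ := exists_between (mem_ball_zero_iff.1 hz)
  have hopen := h.isOpen_image Metric.isOpen_ball (Metric.ball_subset_ball (x := (0 : ℂ)) hR.le)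
  have h1 := hy.eventually_mem (hopen.mem_nhds ⟨z, by simpa using hzR, rfl⟩)
  obtain ⟨n, ⟨v, hv, hvn⟩, hn⟩ := (h1.and (hx1.eventually_const_lt hR)).exists
  have := hinj (Metric.ball_subset_ball hR.le hv) (hx n) hvn
  rw [← this] at hn
  exact hn.not_gt (by simpa using hv)

end LogHarmonicData

/-! ### The radius equation and the Bohr inequality. -/

/-- The majorant of the log-harmonic Koebe function. -/
noncomputable def koebeMajorant (r : ℝ) : ℝ := r / (1 - r) * Real.exp (4 * r / (1 - r))

theorem strictMonoOn_koebeMajorant : StrictMonoOn koebeMajorant (Set.Ico 0 1) := by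
  intro r hr s hs hrs
  have h1 : r / (1 - r) < s / (1 - s) := by
    rw [div_lt_div_iff₀ (by linarith [hr.2]) (by linarith [hs.2])]
    nlinarith
  have h0 : 0 ≤ r / (1 - r) := div_nonneg hr.1 (by linarith [hr.2])
  unfold koebeMajorant
  rw [mul_div_assoc, mul_div_assoc]
  gcongr

theorem continuousOn_koebeMajorant : ContinuousOn koebeMajorant (Set.Ico 0 1) := by
  have h : ∀ r ∈ Set.Ico (0 : ℝ) 1, 1 - r ≠ 0 := fun r hr => by linarith [hr.2]
  exact (continuousOn_id.div (by fun_prop) h).mul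
    (((continuousOn_const.mul continuousOn_id).div (by fun_prop) h).rexp)

/-- At a rational point the exponential is replaced by its Taylor polynomial of degree 6 with
remainder, and `e` by a decimal bound; rational arithmetic remains. -/
theorem koebeMajorant_lower_lt : koebeMajorant 0.085265 < 1 / Real.exp 1 ^ 2 := by
  have h1 : (4 * 0.085265 / (1 - 0.085265) : ℝ) = 68212 / 182947 := by norm_num
  have h2 : (0.085265 / (1 - 0.085265) : ℝ) = 17053 / 182947 := by norm_num
  have hb := (abs_le.1 (Real.exp_bound (x := 68212 / 182947) (by norm_num [abs_le])
    (n := 7) (by norm_num))).2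
  norm_num [Finset.sum_range_succ, Nat.factorial, abs_of_pos] at hb
  rw [koebeMajorant, h1, h2, lt_div_iff₀ (by positivity)]
  have he : Real.exp 1 ^ 2 ≤ 2.7182818286 ^ 2 := by
    gcongr
    exact Real.exp_one_lt_d9.le
  have he2 : Real.exp (68212 / 182947) ≤ 1.451873 := by linarith
  calc _ ≤ 17053 / 182947 * 1.451873 * (2.7182818286 : ℝ) ^ 2 := by gcongr
    _ < 1 := by norm_num

theorem lt_koebeMajorant_upper : 1 / Real.exp 1 ^ 2 < koebeMajorant 0.085275 := by
  have h1 : (4 * 0.085275 / (1 - 0.085275) : ℝ) = 13644 / 36589 := by norm_num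
  have h2 : (0.085275 / (1 - 0.085275) : ℝ) = 3411 / 36589 := by norm_num
  have hb := (abs_le.1 (Real.exp_bound (x := 13644 / 36589) (by norm_num [abs_le])
    (n := 7) (by norm_num))).1
  norm_num [Finset.sum_range_succ, Nat.factorial, abs_of_pos] at hb
  rw [koebeMajorant, h1, h2, div_lt_iff₀ (by positivity)]
  have he : 2.7182818283 ^ 2 ≤ Real.exp 1 ^ 2 := by
    gcongr
    exact Real.exp_one_gt_d9.le
  have he2 : 1.45193 ≤ Real.exp (13644 / 36589) := by linarith
  calc 1 < 3411 / 36589 * 1.45193 * (2.7182818283 : ℝ) ^ 2 := by norm_num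
    _ ≤ _ := by gcongr

/-- The endpoints are `0.08527 ± 5·10⁻⁶`, so the intermediate value theorem yields the root and its
approximation together. -/
theorem exists_root_koebeMajorant :
    ∃ r ∈ Set.Icc (0.085265 : ℝ) 0.085275, koebeMajorant r = 1 / Real.exp 1 ^ 2 := by
  have hc : ContinuousOn koebeMajorant (Set.Icc 0.085265 0.085275) :=
    continuousOn_koebeMajorant.mono fun r hr =>
      ⟨by linarith [hr.1], by linarith [hr.2]⟩
  exact intermediate_value_Icc (by norm_num) hc
    ⟨koebeMajorant_lower_lt.le, lt_koebeMajorant_upper.le⟩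

theorem hasSum_four_add_inv_mul_pow {x : ℝ} (h0 : 0 ≤ x) (h1 : x < 1) :
    HasSum (fun n : ℕ => (4 + 1 / ((n + 1 : ℕ) : ℝ)) * x ^ (n + 1))
      (4 * x / (1 - x) + -Real.log (1 - x)) := by
  have hg := ((hasSum_geometric_of_lt_one h0 h1).mul_left (4 * x))
  have hl := Real.hasSum_pow_div_log_of_abs_lt_one (abs_lt.2 ⟨by linarith, h1⟩)
  convert! hg.add hl using 2 with n
  push_cast
  ring

theorem mul_exp_four_add_neg_log {x : ℝ} (h1 : x < 1) :
    x * Real.exp (4 * x / (1 - x) + -Real.log (1 - x)) = koebeMajorant x := by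
  rw [Real.exp_add, Real.exp_neg, Real.exp_log (by linarith), koebeMajorant]
  ring

/-- Since `(2 + 1/n)(2 - 1/n) = (4n² - 1)/n²`, the weighted product contributes exactly `1/n`; the
rotation `e^{it}` does not affect the triangle inequality. -/
theorem norm_bohr_coeff_le {a b : ℂ} {n : ℕ} (hn : n ≠ 0) (t : ℝ)
    (ha : ‖a‖ ≤ 2 + 1 / n) (hb : ‖b‖ ≤ 2 - 1 / n) :
    ‖a + Complex.exp (t * Complex.I) * b + (n : ℂ) / (4 * (n : ℂ) ^ 2 - 1) * a * b‖ ≤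
      4 + 1 / n := by
  have hn1 : (1 : ℝ) ≤ n := by exact_mod_cast Nat.one_le_iff_ne_zero.2 hn
  have hd : (0 : ℝ) < 4 * (n : ℝ) ^ 2 - 1 := by nlinarith
  have e : (n : ℂ) / (4 * (n : ℂ) ^ 2 - 1) = ((n / (4 * (n : ℝ) ^ 2 - 1) : ℝ) : ℂ) := by
    push_cast; rfl
  have h1 : ‖(n : ℂ) / (4 * (n : ℂ) ^ 2 - 1) * a * b‖ ≤
      n / (4 * (n : ℝ) ^ 2 - 1) * (2 + 1 / n) * (2 - 1 / n) := by
    rw [norm_mul, norm_mul, e, Complex.norm_of_nonneg (by positivity)]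
    gcongr
  have h2 : n / (4 * (n : ℝ) ^ 2 - 1) * (2 + 1 / n) * (2 - 1 / n) = 1 / n := by
    have hd' := hd.ne'
    have hn0 : (n : ℝ) ≠ 0 := by positivity
    rw [show (2 + 1 / n : ℝ) = (2 * n + 1) / n by field_simp,
      show (2 - 1 / n : ℝ) = (2 * n - 1) / n by field_simp, div_mul_div_comm, div_mul_div_comm,
      div_eq_div_iff (by positivity) hn0]
    ring
  have h3 : ‖Complex.exp (t * Complex.I) * b‖ ≤ 2 - 1 / n := by
    rw [norm_mul, Complex.norm_exp_ofReal_mul_I, one_mul]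
    exact hb
  calc _ ≤ ‖a‖ + ‖Complex.exp (t * Complex.I) * b‖ +
        ‖(n : ℂ) / (4 * (n : ℂ) ^ 2 - 1) * a * b‖ := norm_add₃_le
    _ ≤ (2 + 1 / n) + (2 - 1 / n) + 1 / n := by
      rw [h2] at h1
      gcongr
    _ = _ := by ring

theorem bohrInequalityUpTo_of_koebeMajorant_le {r : ℝ} (hr : r ∈ Set.Ico (0 : ℝ) 1)
    (hle : koebeMajorant r ≤ Real.exp (-2)) : BohrInequalityUpTo r := by
  intro f h g a b hf hrep t z hz
  obtain ⟨A, B, w, hdata⟩ := hf.starlike.exists_data hrep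
  have hz1 : ‖z‖ < 1 := hz.trans_lt hr.2
  have hs := hasSum_four_add_inv_mul_pow (norm_nonneg z) hz1
  have hterm : ∀ n : ℕ, bohrTerm a b t ‖z‖ (n + 1) ≤
      (4 + 1 / ((n + 1 : ℕ) : ℝ)) * ‖z‖ ^ (n + 1) := fun n => by
    have ha := hdata.norm_alpha_le (Nat.succ_ne_zero n)
    have hb := hdata.norm_beta_le (Nat.succ_ne_zero n)
    simp only [Nat.succ_ne_zero, if_false] at ha hb
    unfold bohrTerm
    gcongr
    exact norm_bohr_coeff_le (Nat.succ_ne_zero n) t ha hb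
  have hnn : ∀ n : ℕ, 0 ≤ bohrTerm a b t ‖z‖ (n + 1) := fun n => by
    unfold bohrTerm; positivity
  have hsum := Summable.of_nonneg_of_le hnn hterm hs.summable
  refine ⟨hsum, ?_⟩
  calc bohrMajorant a b t ‖z‖ ≤ ‖z‖ * Real.exp (4 * ‖z‖ / (1 - ‖z‖) + -Real.log (1 - ‖z‖)) := by
        unfold bohrMajorant
        gcongr
        rw [← hs.tsum_eq]
        exact hsum.tsum_le_tsum hterm hs.summable
    _ = koebeMajorant ‖z‖ := mul_exp_four_add_neg_log hz1
    _ ≤ koebeMajorant r :=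
        strictMonoOn_koebeMajorant.monotoneOn ⟨norm_nonneg z, hz1⟩ hr hz
    _ ≤ Real.exp (-2) := hle
    _ ≤ distZeroBoundary f := hdata.exp_neg_two_le_distZeroBoundary hf.starlike.injOn

/-! ### The Koebe function: coefficients and majorant. -/

section KoebeSeries

theorem one_sub_ne_zero_of_mem_ball {z : ℂ} (hz : z ∈ Metric.ball (0 : ℂ) 1) : 1 - z ≠ 0 :=
  fun h => by
    rw [← sub_eq_zero.1 h] at hz
    simp at hz

theorem hasSum_two_mul_pow {z : ℂ} (hz : z ∈ Metric.ball (0 : ℂ) 1) :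
    HasSum (fun n : ℕ => 2 * z ^ (n + 1)) (2 * z / (1 - z)) := by
  have := (hasSum_geometric_of_norm_lt_one (mem_ball_zero_iff.1 hz)).mul_left (2 * z)
  rw [← div_eq_mul_inv] at this
  convert! this using 2 with n
  ring

theorem hasSum_inv_mul_pow {z : ℂ} (hz : z ∈ Metric.ball (0 : ℂ) 1) :
    HasSum (fun n : ℕ => 1 / ((n + 1 : ℕ) : ℂ) * z ^ (n + 1)) (-Complex.log (1 - z)) := by
  have h := Complex.hasSum_taylorSeries_neg_log (mem_ball_zero_iff.1 hz)
  rw [← hasSum_nat_add_iff' 1] at h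
  simpa [div_eq_inv_mul] using h

/-- The exponent is `2z/(1-z) - log(1-z)`. At `n = 0` the formula takes the junk value 2, which
never enters. -/
theorem isExpSeries_koebeH : IsExpSeries koebeH (fun n => 2 + 1 / n) := by
  intro z hz
  have h := (hasSum_two_mul_pow hz).add (hasSum_inv_mul_pow hz)
  simp only [← add_mul] at h
  refine ⟨h.summable, ?_⟩
  rw [h.tsum_eq, Complex.exp_add, Complex.exp_neg, Complex.exp_log (one_sub_ne_zero_of_mem_ball hz),
    koebeH]
  ring

theorem isExpSeries_koebeG : IsExpSeries koebeG (fun n => 2 - 1 / n) := by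
  intro z hz
  have h := (hasSum_two_mul_pow hz).sub (hasSum_inv_mul_pow hz)
  simp only [← sub_mul] at h
  refine ⟨h.summable, ?_⟩
  rw [h.tsum_eq, sub_neg_eq_add, Complex.exp_add,
    Complex.exp_log (one_sub_ne_zero_of_mem_ball hz), koebeG]
  ring

theorem hasLogHarmonicRep_koebe :
    HasLogHarmonicRep koebeLH koebeH koebeG (fun n => 2 + 1 / n) (fun n => 2 - 1 / n) :=
  ⟨fun _ _ => rfl, isExpSeries_koebeH, isExpSeries_koebeG⟩

/-- For `t = 0` all three summands are positive reals, so the triangle inequality is an equality. -/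
theorem bohrTerm_koebe (r : ℝ) {n : ℕ} (hn : n ≠ 0) :
    bohrTerm (fun n => 2 + 1 / n) (fun n => 2 - 1 / n) 0 r n = (4 + 1 / n) * r ^ n := by
  have hn1 : (1 : ℝ) ≤ n := by exact_mod_cast Nat.one_le_iff_ne_zero.2 hn
  have hd : (0 : ℝ) < 4 * (n : ℝ) ^ 2 - 1 := by nlinarith
  have hd' : (4 * (n : ℂ) ^ 2 - 1) ≠ 0 := by exact_mod_cast hd.ne'
  have hn0 : (n : ℂ) ≠ 0 := Nat.cast_ne_zero.2 hn
  have e : (2 + 1 / n : ℂ) + Complex.exp ((0 : ℝ) * Complex.I) * (2 - 1 / n) +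
      (n : ℂ) / (4 * (n : ℂ) ^ 2 - 1) * (2 + 1 / n) * (2 - 1 / n) = ((4 + 1 / n : ℝ) : ℂ) := by
    have h1 : (n : ℂ) / (4 * (n : ℂ) ^ 2 - 1) * (2 + 1 / n) * (2 - 1 / n) = 1 / n := by
      rw [show (2 + 1 / n : ℂ) = (2 * n + 1) / n by field_simp,
        show (2 - 1 / n : ℂ) = (2 * n - 1) / n by field_simp, div_mul_div_comm, div_mul_div_comm,
        div_eq_div_iff (by simp [hn0, hd']) hn0]
      ring
    rw [h1]
    push_cast
    simp
    ring
  rw [bohrTerm, e, Complex.norm_of_nonneg (by positivity)]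

theorem hasSum_bohrTerm_koebe {r : ℝ} (h0 : 0 ≤ r) (h1 : r < 1) :
    HasSum (fun n : ℕ => bohrTerm (fun n => 2 + 1 / n) (fun n => 2 - 1 / n) 0 r (n + 1))
      (4 * r / (1 - r) + -Real.log (1 - r)) := by
  simpa only [bohrTerm_koebe r (Nat.succ_ne_zero _)] using hasSum_four_add_inv_mul_pow h0 h1

theorem bohrMajorant_koebe {r : ℝ} (h0 : 0 ≤ r) (h1 : r < 1) :
    bohrMajorant (fun n => 2 + 1 / n) (fun n => 2 - 1 / n) 0 r = koebeMajorant r := by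
  rw [bohrMajorant, (hasSum_bohrTerm_koebe h0 h1).tsum_eq, mul_exp_four_add_neg_log h1]

end KoebeSeries

/-! ### The Koebe function is log-harmonic. -/

section KoebeLogHarmonic

theorem hasDerivAt_two_mul_div_one_sub {z : ℂ} (hz : 1 - z ≠ 0) :
    HasDerivAt (fun z : ℂ => 2 * z / (1 - z)) (2 / (1 - z) ^ 2) z := by
  convert! ((hasDerivAt_id z).const_mul 2).div ((hasDerivAt_id z).const_sub 1) hz using 1
  simp
  ring

theorem hasDerivAt_id_mul_koebeH {z : ℂ} (hz : 1 - z ≠ 0) :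
    HasDerivAt (fun z => z * koebeH z) ((1 + z) / (1 - z) ^ 2 * koebeH z) z := by
  have h1 : HasDerivAt (fun z : ℂ => z / (1 - z)) (1 / (1 - z) ^ 2) z := by
    convert! (hasDerivAt_id z).div ((hasDerivAt_id z).const_sub 1) hz using 1
    simp
  convert! h1.mul (hasDerivAt_two_mul_div_one_sub hz).cexp using 1
  · ext y
    simp only [koebeH, Pi.mul_apply]
    ring
  · simp only [koebeH]
    field_simp
    ring

/-- The quotient `g₀'/g₀` coincides with `(z h₀)'/h₀`, which is why the equation holds with `w(z) =
z`. -/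
theorem hasDerivAt_koebeG {z : ℂ} (hz : 1 - z ≠ 0) :
    HasDerivAt koebeG ((1 + z) / (1 - z) ^ 2 * koebeG z) z := by
  convert! ((hasDerivAt_id z).const_sub 1).mul (hasDerivAt_two_mul_div_one_sub hz).cexp using 1
  simp only [koebeG, id]
  field_simp
  ring

theorem koebeH_ne_zero {z : ℂ} (hz : 1 - z ≠ 0) : koebeH z ≠ 0 :=
  mul_ne_zero (one_div_ne_zero hz) (Complex.exp_ne_zero _)

theorem koebeG_ne_zero {z : ℂ} (hz : 1 - z ≠ 0) : koebeG z ≠ 0 :=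
  mul_ne_zero hz (Complex.exp_ne_zero _)

theorem koebeLH_ne_zero {z : ℂ} (hz : 1 - z ≠ 0) (hz0 : z ≠ 0) : koebeLH z ≠ 0 :=
  mul_ne_zero (mul_ne_zero hz0 (koebeH_ne_zero hz)) (by simpa using koebeG_ne_zero hz)

theorem wirtingerZ_koebeLH {z : ℂ} (hz : 1 - z ≠ 0) :
    z * wirtingerZ koebeLH z = (1 + z) / (1 - z) ^ 2 * koebeLH z := by
  have := wirtingerZ_mul_conj (hasDerivAt_id_mul_koebeH hz) (hasDerivAt_koebeG hz)
  change z * wirtingerZ (fun z => z * koebeH z * conj (koebeG z)) z = _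
  rw [this, koebeLH]
  ring

theorem wirtingerZBar_koebeLH {z : ℂ} (hz : 1 - z ≠ 0) :
    wirtingerZBar koebeLH z = conj ((1 + z) / (1 - z) ^ 2) * koebeLH z := by
  have := wirtingerZBar_mul_conj (hasDerivAt_id_mul_koebeH hz) (hasDerivAt_koebeG hz)
  change wirtingerZBar (fun z => z * koebeH z * conj (koebeG z)) z = _
  rw [this, koebeLH, map_mul]
  ring

theorem contDiffAt_koebeLH {z : ℂ} (hz : 1 - z ≠ 0) : ContDiffAt ℝ 1 koebeLH z := by
  have h1 : ContDiffAt ℂ 1 (fun z : ℂ => 1 - z) z := contDiffAt_const.sub contDiffAt_id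
  have h2 : ContDiffAt ℂ 1 (fun z : ℂ => Complex.exp (2 * z / (1 - z))) z :=
    ((contDiffAt_const.mul contDiffAt_id).div h1 hz).cexp
  have hu : ContDiffAt ℂ 1 (fun z => z * koebeH z) z :=
    contDiffAt_id.mul ((contDiffAt_const.div h1 hz).mul h2)
  have hg : ContDiffAt ℂ 1 koebeG z := h1.mul h2
  exact (hu.restrict_scalars ℝ).mul
    (Complex.conjCLE.contDiff.contDiffAt.comp z (hg.restrict_scalars ℝ))

theorem re_one_add_div_one_sub_pos {z : ℂ} (hz : z ∈ Metric.ball (0 : ℂ) 1) :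
    0 < ((1 + z) / (1 - z)).re := by
  have hz1 : ‖z‖ < 1 := by simpa using hz
  exact (div_pos (by linarith) (by positivity)).trans_le
    (div_le_re_one_add_div_one_sub le_rfl hz1)

theorem isLogHarmonic_koebeLH : IsLogHarmonic koebeLH where
  continuousOn := fun z hz =>
    (contDiffAt_koebeLH (one_sub_ne_zero_of_mem_ball hz)).continuousAt.continuousWithinAt
  contDiffOn := fun z hz =>
    (contDiffAt_koebeLH (one_sub_ne_zero_of_mem_ball hz.1)).contDiffWithinAt
  nonconstant := by
    rintro ⟨c, hc⟩
    have h0 := hc 0 (by simp)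
    have h1 := hc (1 / 2) (by norm_num)
    rw [← h0] at h1
    refine koebeLH_ne_zero (z := 1 / 2) (by norm_num) (by norm_num) (h1.trans ?_)
    simp [koebeLH]
  equation := by
    refine ⟨id, differentiableOn_id, fun z hz => by simpa using hz, fun z hz hf => ?_⟩
    have hz1 := one_sub_ne_zero_of_mem_ball hz
    have hf' : conj (koebeLH z) ≠ 0 := by simpa using hf
    rw [wirtingerZBar_koebeLH hz1, id, ← mul_div_assoc, wirtingerZ_koebeLH hz1, map_mul,
      Complex.conj_conj, mul_div_cancel_right₀ _ hf', mul_div_cancel_right₀ _ hf]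

theorem re_pos_koebeLH {z : ℂ} (hz : z ∈ Metric.ball (0 : ℂ) 1) (hz0 : z ≠ 0) :
    0 < ((z * wirtingerZ koebeLH z - conj z * wirtingerZBar koebeLH z) / koebeLH z).re := by
  have hz1 := one_sub_ne_zero_of_mem_ball hz
  have hf := koebeLH_ne_zero hz1 hz0
  have e : (z * wirtingerZ koebeLH z - conj z * wirtingerZBar koebeLH z) / koebeLH z =
      (1 + z) / (1 - z) ^ 2 - conj (z * ((1 + z) / (1 - z) ^ 2)) := by
    rw [wirtingerZBar_koebeLH hz1, wirtingerZ_koebeLH hz1, map_mul]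
    field_simp
  have e2 : (1 + z) / (1 - z) = (1 + z) / (1 - z) ^ 2 - z * ((1 + z) / (1 - z) ^ 2) := by
    field_simp
  have := re_one_add_div_one_sub_pos hz
  rw [e, Complex.sub_re, Complex.conj_re, ← Complex.sub_re, ← e2]
  exact this

end KoebeLogHarmonic

/-! ### Univalence and starlikeness of the Koebe function. -/

section KoebeHalfPlane

/-- The positive factor of the Koebe mapping in the half-plane coordinate `p = (1 + z) / (1 - z)`. -/
noncomputable def koebeScale (p : ℂ) : ℝ := Real.exp (2 * p.re - 2) / Complex.normSq (p + 1)

theorem koebeScale_pos {p : ℂ} (hp : 0 < p.re) : 0 < koebeScale p :=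
  div_pos (Real.exp_pos _) (Complex.normSq_pos.2 (add_one_ne_zero_of_re_pos hp))

/-- The analytic function with the modulus of the Koebe mapping, in the half-plane coordinate. -/
noncomputable def koebeModulus (p : ℂ) : ℂ := (p - 1) / (p + 1) * Complex.exp (2 * p - 2)

theorem norm_koebeModulus {p : ℂ} (hp : 0 < p.re) :
    ‖koebeModulus p‖ = ‖p ^ 2 - 1‖ * koebeScale p := by
  have h := add_one_ne_zero_of_re_pos hp
  have h' : ‖p + 1‖ ≠ 0 := norm_ne_zero_iff.2 h
  rw [koebeModulus, koebeScale, norm_mul, norm_div, Complex.norm_exp, Complex.normSq_eq_norm_sq,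
    show p ^ 2 - 1 = (p - 1) * (p + 1) by ring, norm_mul]
  simp
  field_simp

/-- The positive factor leaves the argument to `p² - 1` alone, so the preimage of a ray consists of
points whose `p² - 1` are positive multiples of one another. -/
theorem koebeLH_cayley {p : ℂ} (hp : 0 < p.re) :
    koebeLH ((p - 1) / (p + 1)) = (p ^ 2 - 1) * koebeScale p := by
  have h := add_one_ne_zero_of_re_pos hp
  have h' : conj (p + 1) ≠ 0 := (map_ne_zero _).2 h
  have e1 : 1 - (p - 1) / (p + 1) = 2 / (p + 1) := by field_simp; ring
  have e2 : 2 * ((p - 1) / (p + 1)) / (2 / (p + 1)) = p - 1 := by field_simp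
  have e3 : ((koebeScale p : ℝ) : ℂ) =
      Complex.exp (p - 1) * conj (Complex.exp (p - 1)) / ((p + 1) * conj (p + 1)) := by
    rw [Complex.mul_conj, Complex.mul_conj, Complex.normSq_eq_norm_sq (Complex.exp _),
      Complex.norm_exp, ← Real.exp_nat_mul, koebeScale]
    push_cast
    simp
    ring_nf
  rw [koebeLH, koebeH, koebeG, e1, e2, e3]
  simp only [map_mul, map_div₀, Complex.conj_ofNat]
  field_simp
  ring

theorem cayley_mem_ball {p : ℂ} (hp : 0 < p.re) : (p - 1) / (p + 1) ∈ Metric.ball (0 : ℂ) 1 := by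
  simpa using norm_sub_one_div_add_one_lt hp

theorem exists_cayley {z : ℂ} (hz : z ∈ Metric.ball (0 : ℂ) 1) :
    ∃ p : ℂ, 0 < p.re ∧ z = (p - 1) / (p + 1) := by
  have h := one_sub_ne_zero_of_mem_ball hz
  refine ⟨(1 + z) / (1 - z), re_one_add_div_one_sub_pos hz, ?_⟩
  rw [div_sub_one h, div_add_one h, div_div_div_cancel_right₀ h]
  ring

theorem eq_of_sq_eq_of_re_pos {p q : ℂ} (hp : 0 < p.re) (hq : 0 < q.re) (h : p ^ 2 = q ^ 2) :
    p = q := by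
  rcases sq_eq_sq_iff_eq_or_eq_neg.1 h with h | h
  · exact h
  · have := congrArg Complex.re h
    simp at this
    linarith

/-- The square root with positive real part. -/
noncomputable def slitSqrt (y : ℂ) : ℂ := Complex.exp (Complex.log y / 2)

theorem slitSqrt_sq {y : ℂ} (hy : y ∈ Complex.slitPlane) : slitSqrt y ^ 2 = y := by
  rw [slitSqrt, ← Complex.exp_nat_mul]
  push_cast
  rw [mul_div_cancel₀ _ (two_ne_zero), Complex.exp_log (Complex.slitPlane_ne_zero hy)]

theorem slitSqrt_re_pos {y : ℂ} (hy : y ∈ Complex.slitPlane) : 0 < (slitSqrt y).re := by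
  rw [slitSqrt, Complex.exp_re]
  have h1 := Complex.neg_pi_lt_arg y
  have h2 : y.arg < Real.pi :=
    lt_of_le_of_ne (Complex.arg_le_pi y) (Complex.mem_slitPlane_iff_arg.1 hy).1
  have e : (Complex.log y / 2).im = y.arg / 2 := by simp [Complex.log_im]
  rw [e]
  exact mul_pos (Real.exp_pos _) (Real.cos_pos_of_mem_Ioo ⟨by linarith, by linarith⟩)

theorem sq_mem_slitPlane {p : ℂ} (hp : 0 < p.re) : p ^ 2 ∈ Complex.slitPlane := by
  rw [Complex.mem_slitPlane_iff, sq, Complex.mul_re, Complex.mul_im]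
  by_cases h : p.im = 0
  · left
    rw [h]
    nlinarith
  · right
    intro h2
    have : p.re * p.im = 0 := by linarith
    simp [hp.ne', h] at this

theorem one_add_mul_mem_slitPlane {p : ℂ} (hp : 0 < p.re) {t : ℝ} (ht : t ∈ Set.Icc (0 : ℝ) 1) :
    1 + t * (p ^ 2 - 1) ∈ Complex.slitPlane := by
  have := Complex.starConvex_one_slitPlane (sq_mem_slitPlane hp) (sub_nonneg.2 ht.2) ht.1
    (sub_add_cancel 1 t)
  convert! this using 1
  simp
  ring

theorem hasDerivAt_slitSqrt {y : ℂ} (hy : y ∈ Complex.slitPlane) :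
    HasDerivAt slitSqrt (1 / (2 * slitSqrt y)) y := by
  convert! ((Complex.hasDerivAt_log hy).div_const 2).cexp using 1
  have h1 := slitSqrt_sq hy
  have h2 : slitSqrt y ≠ 0 := Complex.exp_ne_zero _
  change _ = slitSqrt y * _
  nth_rewrite 3 [← h1]
  field_simp

/-- The path `t ↦ √(1 + t (p² - 1))` in the right half-plane; it is mapped by the Koebe mapping onto
a segment of a ray from the origin. -/
noncomputable def koebePath (p : ℂ) (t : ℝ) : ℂ := slitSqrt (1 + t * (p ^ 2 - 1))

variable {p : ℂ} {t : ℝ}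

theorem koebePath_sq (hp : 0 < p.re) (ht : t ∈ Set.Icc (0 : ℝ) 1) :
    koebePath p t ^ 2 = 1 + t * (p ^ 2 - 1) := slitSqrt_sq (one_add_mul_mem_slitPlane hp ht)

theorem koebePath_re_pos (hp : 0 < p.re) (ht : t ∈ Set.Icc (0 : ℝ) 1) :
    0 < (koebePath p t).re := slitSqrt_re_pos (one_add_mul_mem_slitPlane hp ht)

theorem eq_koebePath (hp : 0 < p.re) (ht : t ∈ Set.Icc (0 : ℝ) 1) {q : ℂ} (hq : 0 < q.re)
    (h : q ^ 2 = 1 + t * (p ^ 2 - 1)) : q = koebePath p t :=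
  eq_of_sq_eq_of_re_pos hq (koebePath_re_pos hp ht) (h.trans (koebePath_sq hp ht).symm)

theorem hasDerivAt_koebePath (hp : 0 < p.re) (ht : t ∈ Set.Icc (0 : ℝ) 1) :
    HasDerivAt (koebePath p) ((p ^ 2 - 1) / (2 * koebePath p t)) t := by
  have h1 : HasDerivAt (fun t : ℝ => 1 + (t : ℂ) * (p ^ 2 - 1)) (p ^ 2 - 1) t := by
    have : HasDerivAt (fun t : ℝ => (t : ℂ)) 1 t := Complex.ofRealCLM.hasDerivAt
    simpa using (this.mul_const (p ^ 2 - 1)).const_add 1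
  convert! (hasDerivAt_slitSqrt (one_add_mul_mem_slitPlane hp ht)).comp t h1 using 1
  rw [koebePath]
  ring

/-- With `E` for `koebeModulus` and `s` for the point of the path, `E'/E = 2s²/(s² - 1)` and `ds/dt
= (s² - 1)/(2ts)`. Hence `E` has logarithmic derivative `s/t` along the path, and its real part is
positive. -/
theorem hasDerivAt_koebeModulus_koebePath (hp : 0 < p.re) (ht : t ∈ Set.Icc (0 : ℝ) 1)
    (ht0 : t ≠ 0) :
    HasDerivAt (fun t => koebeModulus (koebePath p t))
      (((1 / t : ℝ) : ℂ) * (koebePath p t * koebeModulus (koebePath p t))) t := by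
  have hq := koebePath_re_pos hp ht
  have hq1 := add_one_ne_zero_of_re_pos hq
  have hs := koebePath_sq hp ht
  have hq0 : koebePath p t ≠ 0 := fun h => by simp [h] at hq
  have hd : HasDerivAt koebeModulus
      ((2 / (koebePath p t + 1) ^ 2 + 2 * ((koebePath p t - 1) / (koebePath p t + 1))) *
        Complex.exp (2 * koebePath p t - 2)) (koebePath p t) := by
    have h1 := ((hasDerivAt_id (koebePath p t)).sub_const 1).div
      ((hasDerivAt_id (koebePath p t)).add_const 1) hq1
    have h2 := (((hasDerivAt_id (koebePath p t)).const_mul 2).sub_const 2).cexp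
    convert! h1.mul h2 using 1
    simp
    ring
  convert! hd.comp t (hasDerivAt_koebePath hp ht) using 1
  have ht0' : (t : ℂ) ≠ 0 := by exact_mod_cast ht0
  have hk : p ^ 2 - 1 = (koebePath p t ^ 2 - 1) / t := by
    rw [hs]; field_simp; ring
  rw [hk, koebeModulus]
  push_cast
  field_simp
  ring

theorem continuousOn_koebeModulus_koebePath (hp : 0 < p.re) :
    ContinuousOn (fun t => koebeModulus (koebePath p t)) (Set.Icc 0 1) := by
  have h1 : ContinuousOn (koebePath p) (Set.Icc 0 1) := fun t ht =>
    (hasDerivAt_koebePath hp ht).continuousAt.continuousWithinAt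
  exact ((h1.sub continuousOn_const).div (h1.add continuousOn_const) fun t ht =>
    add_one_ne_zero_of_re_pos (koebePath_re_pos hp ht)).mul
      (((continuousOn_const.mul h1).sub continuousOn_const).cexp)

theorem koebePath_zero (p : ℂ) : koebePath p 0 = 1 := by simp [koebePath, slitSqrt]

theorem koebePath_one (hp : 0 < p.re) : koebePath p 1 = p :=
  (eq_koebePath hp (by simp) hp (by simp)).symm

theorem strictMonoOn_norm_koebeModulus (hp : 0 < p.re) (hp1 : p ^ 2 - 1 ≠ 0) :
    StrictMonoOn (fun t => ‖koebeModulus (koebePath p t)‖ ^ 2) (Set.Icc 0 1) := by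
  refine strictMonoOn_of_deriv_pos (convex_Icc 0 1)
    ((continuousOn_koebeModulus_koebePath hp).norm.pow 2) fun t ht => ?_
  rw [interior_Icc] at ht
  have ht' := Set.Ioo_subset_Icc_self ht
  have ht0 : (t : ℂ) ≠ 0 := by exact_mod_cast ht.1.ne'
  have hq := koebePath_re_pos hp ht'
  have hE : 0 < ‖koebeModulus (koebePath p t)‖ := by
    rw [norm_koebeModulus hq, koebePath_sq hp ht', add_sub_cancel_left]
    exact mul_pos (norm_pos_iff.2 (mul_ne_zero ht0 hp1)) (koebeScale_pos hq)
  rw [(hasDerivAt_koebeModulus_koebePath hp ht' ht.1.ne').norm_sq.deriv]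
  have e : inner ℝ (koebeModulus (koebePath p t))
      (((1 / t : ℝ) : ℂ) * (koebePath p t * koebeModulus (koebePath p t))) =
      1 / t * ((koebePath p t).re * ‖koebeModulus (koebePath p t)‖ ^ 2) := by
    rw [Complex.inner, mul_assoc, mul_assoc, Complex.re_ofReal_mul, Complex.mul_conj,
      Complex.normSq_eq_norm_sq, Complex.re_mul_ofReal]
  rw [e]
  have := ht.1
  positivity

/-- Equal values give `q² - 1 = t (p² - 1)` with `t` the ratio of the scales, and by symmetry `t ≤
1`. Thus `q` lies on the path ending at `p` and has the same modulus under the mapping, so strict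
monotonicity forces `t = 1`. -/
theorem injOn_koebeLH : Set.InjOn koebeLH (Metric.ball 0 1) := by
  have key : ∀ p q : ℂ, 0 < p.re → 0 < q.re → p ^ 2 - 1 ≠ 0 →
      (p ^ 2 - 1) * koebeScale p = (q ^ 2 - 1) * koebeScale q →
      koebeScale p ≤ koebeScale q → p = q := by
    intro p q hp hq hp1 he hle
    have hsp := koebeScale_pos hp
    have hsq := koebeScale_pos hq
    have hsq' : (koebeScale q : ℂ) ≠ 0 := by exact_mod_cast hsq.ne'
    have ht : koebeScale p / koebeScale q ∈ Set.Icc (0 : ℝ) 1 :=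
      ⟨by positivity, (div_le_one hsq).2 hle⟩
    have hq2 : q ^ 2 = 1 + ((koebeScale p / koebeScale q : ℝ) : ℂ) * (p ^ 2 - 1) := by
      push_cast
      field_simp
      linear_combination -he
    have hqp := eq_koebePath hp ht hq hq2
    have hnorm : ‖koebeModulus p‖ = ‖koebeModulus q‖ := by
      have := congrArg norm he
      rw [norm_mul, norm_mul, Complex.norm_of_nonneg hsp.le, Complex.norm_of_nonneg hsq.le] at this
      rw [norm_koebeModulus hp, norm_koebeModulus hq, this]
    have := (strictMonoOn_norm_koebeModulus hp hp1).injOn ht (Set.right_mem_Icc.2 zero_le_one)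
      (by rw [← hqp, koebePath_one hp, hnorm])
    rw [hqp, this, koebePath_one hp]
  intro z hz y hy hzy
  by_cases hz0 : z = 0
  · by_contra hne
    refine koebeLH_ne_zero (one_sub_ne_zero_of_mem_ball hy)
      (fun h => hne (hz0.trans h.symm)) (hzy.symm.trans ?_)
    simp [hz0, koebeLH]
  have hy0 : y ≠ 0 := fun h => by
    refine koebeLH_ne_zero (one_sub_ne_zero_of_mem_ball hz) hz0 (hzy.trans ?_)
    simp [h, koebeLH]
  obtain ⟨p, hp, rfl⟩ := exists_cayley hz
  obtain ⟨q, hq, rfl⟩ := exists_cayley hy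
  have hne : ∀ p : ℂ, 0 < p.re → (p - 1) / (p + 1) ≠ 0 → p ^ 2 - 1 ≠ 0 := fun p hp h => by
    rw [show p ^ 2 - 1 = (p - 1) * (p + 1) by ring]
    exact mul_ne_zero (fun h0 => h (by rw [h0, zero_div])) (add_one_ne_zero_of_re_pos hp)
  rw [koebeLH_cayley hp, koebeLH_cayley hq] at hzy
  rcases le_total (koebeScale p) (koebeScale q) with hle | hle
  · rw [key p q hp hq (hne p hp hz0) hzy hle]
  · rw [key q p hq hp (hne q hq hy0) hzy.symm hle]

/-- Along the path the argument is constant and the modulus runs continuously from 0 to its final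
value, so every point of the segment is attained. -/
theorem starConvex_image_koebeLH : StarConvex ℝ 0 (koebeLH '' Metric.ball 0 1) := by
  rw [starConvex_zero_iff]
  rintro _ ⟨z, hz, rfl⟩ a ha0 ha1
  obtain ⟨p, hp, rfl⟩ := exists_cayley hz
  rw [koebeLH_cayley hp]
  rcases eq_or_ne (p ^ 2 - 1) 0 with hp1 | hp1
  · exact ⟨0, by simp, by simp [hp1, koebeLH]⟩
  have hivt := intermediate_value_Icc zero_le_one (continuousOn_koebeModulus_koebePath hp).norm
  simp only [koebePath_zero, koebePath_one hp] at hivt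
  obtain ⟨t, ht, hta⟩ := hivt (show a * ‖koebeModulus p‖ ∈ _ from
    ⟨by simpa [koebeModulus] using by positivity, mul_le_of_le_one_left (norm_nonneg _) ha1⟩)
  have hq := koebePath_re_pos hp ht
  refine ⟨_, cayley_mem_ball hq, ?_⟩
  simp only at hta
  rw [norm_koebeModulus hq, norm_koebeModulus hp, koebePath_sq hp ht, add_sub_cancel_left, norm_mul,
    Complex.norm_of_nonneg ht.1] at hta
  have hts : t * koebeScale (koebePath p t) = a * koebeScale p := by
    refine mul_left_cancel₀ (norm_ne_zero_iff.2 hp1) ?_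
    linarith
  have hts' : (t : ℂ) * koebeScale (koebePath p t) = a * koebeScale p := by exact_mod_cast hts
  rw [koebeLH_cayley hq, koebePath_sq hp ht, Complex.real_smul]
  linear_combination (p ^ 2 - 1) * hts'

end KoebeHalfPlane

theorem memST0LH_koebeLH : MemST0LH koebeLH where
  starlike := {
    logHarmonic := isLogHarmonic_koebeLH
    map_zero := by simp [koebeLH]
    injOn := injOn_koebeLH
    re_pos := fun _ hz hz0 => re_pos_koebeLH hz hz0 }
  starConvex_image := starConvex_image_koebeLH

/-- The formula for `f₀` is continuous at `-1`, with value `-e^{-2}`; approaching `-1` along the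
negative radius shows that this value is a boundary point. -/
theorem distZeroBoundary_koebeLH : distZeroBoundary koebeLH = Real.exp (-2) := by
  obtain ⟨A, B, w, hdata⟩ := memST0LH_koebeLH.starlike.exists_data hasLogHarmonicRep_koebe
  refine le_antisymm ?_ (hdata.exp_neg_two_le_distZeroBoundary injOn_koebeLH)
  obtain ⟨x, -, hx, hlim⟩ := exists_seq_strictMono_tendsto' (show (0 : ℝ) < 1 by norm_num)
  have hlim' : Filter.Tendsto (fun n => -(x n : ℂ)) Filter.atTop (nhds (-1)) := by
    simpa using ((Complex.continuous_ofReal.tendsto 1).comp hlim).neg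
  have hnorm : ∀ n, ‖-(x n : ℂ)‖ = x n := fun n => by
    rw [norm_neg, Complex.norm_of_nonneg (hx n).1.le]
  have hval : koebeLH (-1) = ((-Real.exp (-2) : ℝ) : ℂ) := by
    have e : (2 * (-1) / (1 - -1) : ℂ) = ((-1 : ℝ) : ℂ) := by norm_num
    rw [koebeLH, koebeH, koebeG, e, ← Complex.ofReal_exp, map_mul, Complex.conj_ofReal]
    have h2 : Real.exp (-2) = Real.exp (-1) * Real.exp (-1) := by rw [← Real.exp_add]; norm_num
    rw [h2]
    push_cast
    simp
    ring
  have hmem := hdata.mem_frontier_of_tendsto injOn_koebeLH (x := fun n => -(x n : ℂ))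
    (y := koebeLH (-1)) (fun n => by rw [mem_ball_zero_iff, hnorm]; exact (hx n).2)
    (by simpa only [hnorm] using hlim)
    ((contDiffAt_koebeLH (by norm_num)).continuousAt.tendsto.comp hlim')
  refine (Metric.infDist_le_dist_of_mem hmem).trans_eq ?_
  rw [hval, dist_zero_left, Complex.norm_real, norm_neg, Real.norm_of_nonneg (Real.exp_pos _).le]

theorem theorem2p7 :
    ∃ r_f : ℝ,
      -- `r_f` is the unique root of the equation in `(0, 1)`, and `r_f ≈ 0.08527`
      (∀ r : ℝ, (r ∈ Set.Ioo (0 : ℝ) 1 ∧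
        r / (1 - r) * Real.exp (4 * r / (1 - r)) = 1 / Real.exp 1 ^ 2) ↔ r = r_f) ∧
      |r_f - 0.08527| ≤ 0.000005 ∧
      -- the inequality holds for `|z| ≤ r_f`
      BohrInequalityUpTo r_f ∧
      -- `r_f` is the largest radius with this property
      IsGreatest {r : ℝ | r ∈ Set.Ioo (0 : ℝ) 1 ∧ BohrInequalityUpTo r} r_f ∧
      -- the log-harmonic Koebe function is extremal: it lies in the class, and for `t = 0`
      -- equality holds on `|z| = r_f` and the inequality fails for `r_f < |z| < 1`
      ∃ a b : ℕ → ℂ,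
        MemST0LH koebeLH ∧ HasLogHarmonicRep koebeLH koebeH koebeG a b ∧
        (∀ z : ℂ, ‖z‖ < 1 → Summable (fun n : ℕ => bohrTerm a b 0 ‖z‖ (n + 1))) ∧
        (∀ z : ℂ, ‖z‖ = r_f → bohrMajorant a b 0 ‖z‖ = distZeroBoundary koebeLH) ∧
        (∀ z : ℂ, r_f < ‖z‖ → ‖z‖ < 1 →
          distZeroBoundary koebeLH < bohrMajorant a b 0 ‖z‖) := by
  obtain ⟨r, hr, hroot⟩ := exists_root_koebeMajorant
  have hr' : r ∈ Set.Ioo (0 : ℝ) 1 := ⟨by linarith [hr.1], by linarith [hr.2]⟩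
  have hexp : 1 / Real.exp 1 ^ 2 = Real.exp (-2) := by
    rw [← Real.exp_nat_mul, one_div, ← Real.exp_neg]
    norm_num
  have hroot' : koebeMajorant r = Real.exp (-2) := hroot.trans hexp
  have hineq : BohrInequalityUpTo r :=
    bohrInequalityUpTo_of_koebeMajorant_le ⟨hr'.1.le, hr'.2⟩ hroot'.le
  have hlt : ∀ s : ℝ, r < s → s < 1 → distZeroBoundary koebeLH <
      bohrMajorant (fun n => 2 + 1 / n) (fun n => 2 - 1 / n) 0 s := fun s hs hs1 => by
    rw [distZeroBoundary_koebeLH, bohrMajorant_koebe (hr'.1.trans hs).le hs1, ← hroot']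
    exact strictMonoOn_koebeMajorant ⟨hr'.1.le, hr'.2⟩ ⟨(hr'.1.trans hs).le, hs1⟩ hs
  refine ⟨r, fun s => ⟨fun ⟨hs, hse⟩ => ?_, ?_⟩, ?_, hineq, ⟨⟨hr', hineq⟩, fun s hs => ?_⟩,
    fun n => 2 + 1 / n, fun n => 2 - 1 / n, memST0LH_koebeLH, hasLogHarmonicRep_koebe,
    fun z hz => (hasSum_bohrTerm_koebe (norm_nonneg z) hz).summable, fun z hz => ?_,
    fun z => hlt ‖z‖⟩
  · exact strictMonoOn_koebeMajorant.injOn ⟨hs.1.le, hs.2⟩ ⟨hr'.1.le, hr'.2⟩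
      (Eq.trans hse hroot.symm)
  · rintro rfl
    exact ⟨hr', hroot⟩
  · rw [abs_le]
    constructor <;> linarith [hr.1, hr.2]
  -- A larger admissible radius `s` is refuted by the Koebe function at the real point `z = s`, with
  -- `t = 0`.
  · by_contra! hrs
    have hn : ‖(s : ℂ)‖ = s := Complex.norm_of_nonneg hs.1.1.le
    have := (hs.2 _ _ _ _ _ memST0LH_koebeLH hasLogHarmonicRep_koebe 0 (s : ℂ) hn.le).2
    rw [hn] at this
    exact this.not_gt (hlt s hrs hs.1.2)
  · rw [hz, bohrMajorant_koebe hr'.1.le hr'.2, hroot', distZeroBoundary_koebeLH]
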